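/- **Setting.** Let $\mathbb T$ be $\mathbb Z$ or $\mathbb R$ and $\mathbb T^+=\mathbb T\cap[0,\infty)$. Let $(\Omega,\mathcal F,\mathbb P)$ be a probability space with sub-$\sigma$-algebras $\mathcal F_s^t$ ($s\le t$ in $\mathbb T$) that together generate $\mathcal F$ and satisfy $\mathcal F_{t_1}^{t_2}\subset\mathcal F_{t_0}^{t_3}$ whenever $t_0\le t_1\le t_2\le t_3$, and let $(\theta^t)_{t\in\mathbb T}$ be a group of measurable maps $\theta^t:\Omega\to\Omega$ preserving $\mathbb P$ with $\theta^\tau\mathcal F_s^t=\mathcal F_{s-\tau}^{t-\tau}$ for all $s\le t$ and $\tau$. Assume that for every $t\in\mathbb T$ the $\sigma$-algebras $\mathcal F_{-\infty}^t=\sigma(\mathcal F_s^t:s\le t)$ and $\mathcal F_t^\infty=\sigma(\mathcal F_t^u:u\ge t)$ are independent. Let $(X,d)$ be a separable metric space that is a Borel subset of its completion. Let $\varphi=(\varphi(t,\omega))_{t\in\mathbb T^+,\omega\in\Omega}$ be a random dynamical system on $X$ over this noise, i.e. a family of continuous maps $\varphi(t,\omega):X\to X$ such that: $\omega\mapsto\varphi(t,\omega)x$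 is $\mathcal F_0^t$-measurable for all $t,x$; $\varphi(0,\omega)=\mathrm{id}_X$; $\varphi(s+t,\omega)=\varphi(t,\theta^s\omega)\circ\varphi(s,\omega)$; and $\varphi(t_n,\omega)x_n\to\varphi(t,\omega)x$ whenever $(t_n)$ is a decreasing sequence in $\mathbb T^+$ converging to $t$ and $x_n\to x$. Put $\varphi_x^t(A)=\mathbb P(\omega:\varphi(t,\omega)x\in A)$. A Borel probability measure $\rho$ on $X$ is *ergodic* if $\rho(A)=\int\varphi_x^t(A)\,\rho(dx)$ for all Borel $A$ and $t\in\mathbb T^+$, and $\rho(A)\in\{0,1\}$ for every Borel $A$ such that, for each $t\in\mathbb T^+$, $\varphi_x^t(A)=\mathbf 1_A(x)$ for $\rho$-a.e. $x$. A set $A\subset X$ *contracts under $\omega$* if $\operatorname{diam}(\varphi(t,\omega)A)\to0$ as $t\to\infty$. An open set $U$ is *$\sigma$-contracting under $\omega$* if it is the union of an increasing sequence of open sets each of which contracts under $\omega$. We say that $\varphi$ is *stable with respect to $\rho$* if with positive probability there is an open set meeting $\operatorname{supp}\rho$ that contracts under $\omega$; and that $\varphi$ is *$\rho$-almost everywhere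 stably synchronising* if for $\mathbb P$-a.e. $\omega$ there is an open set of $\rho$-measure $1$ that is $\sigma$-contracting under $\omega$. For $p\in X$, $\mathfrak C_p$ is the set of pairs $(x,y)\in X\times X$ such that for every $\varepsilon>0$, with positive probability there is $t\in\mathbb T^+$ with $\varphi(t,\omega)x,\varphi(t,\omega)y\in B_\varepsilon(p)$. For $A\subset X$, $\mathfrak C_A$ is the set of pairs $(x,y)$ such that for every neighbourhood $V$ of $\{(a,a):a\in A\}$ in $X\times X$, with positive probability there is $t\in\mathbb T^+$ with $(\varphi(t,\omega)x,\varphi(t,\omega)y)\in V$. $A_\rho$ is the set of $x\in\operatorname{supp}\rho$ such that for every open $U$ with $\rho(U)>0$, with positive probability there is $t\in\mathbb T^+$ with $\varphi(t,\omega)x\in U$. A *$\rho$-full-length rectangle* is a set $A_1\times A_2$ with $A_1,A_2\subset X$ Borel, $\rho(A_1)>0$ and $\rho(A_2)=1$. An integer $n\ge1$ is called a *number of synchronising regions* for $\rho$ if for $\mathbb P$-a.e. $\omega$ there are open sets $U_1,\dots,U_n$, each $\sigma$-contracting under $\omega$ with $\rho(U_i)=\frac1n$, such that for $i<j$, $x\in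 U_i$, $y\in U_j$, the distance $d(\varphi(t,\omega)x,\varphi(t,\omega)y)$ does not tend to $0$ as $t\to\infty$. **Theorem.** Let $\rho$ be an ergodic probability measure of $(\varphi_x^t)$ and suppose that $\varphi$ is stable with respect to $\rho$. The following statements are equivalent: (i) there is a non-$\rho$-null set $R\subset X$ such that for each $p\in R$ the set $\mathfrak C_p$ contains a $\rho$-full-length rectangle; (ii) the set $\mathfrak C_{A_\rho}$ contains a $\rho$-full-length rectangle; (iii) $\varphi$ is $\rho$-almost everywhere stably synchronising; (iv) there is a $\rho$-full set $A\subset\operatorname{supp}\rho$ such that for all $x,y\in A$, $\mathbb P$-a.e. $\omega$ has the property that for every open $U\subset X$ with $\rho(U)>0$ there is $t\in\mathbb T^+$ with $\varphi(t,\omega)x,\varphi(t,\omega)y\in U$; (v) $1$ is a number of synchronising regions for $\rho$. Moreover, there is at most one number of synchronising regions $n_\rho$ for $\rho$ (so (v) says that $n_\rho=1$). -/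

import Mathlib

open MeasureTheory ProbabilityTheory Filter Topology Set

/-- The non-negative times `𝕋⁺ = 𝕋 ∩ [0,∞)`, where the time set `𝕋` is a subgroup of `ℝ`
(the theorem takes it to be the integers or all of `ℝ`). -/
abbrev NonnegTime (T : AddSubgroup ℝ) : Type := {t : T // 0 ≤ t}

/-- A memoryless stationary noise `(Ω, 𝓕, (𝓕_s^t), P, (θ^t))` with two-sided time `T`.
The σ-algebra `sig s t` stands for `𝓕_s^t`; its values for `s > t` play no role. -/
structure MemorylessNoise (T : AddSubgroup ℝ) (Ω : Type*) [mΩ : MeasurableSpace Ω]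
    (P : Measure Ω) where
  sig : T → T → MeasurableSpace Ω
  sig_mono : ∀ t₀ t₁ t₂ t₃ : T, t₀ ≤ t₁ → t₁ ≤ t₂ → t₂ ≤ t₃ → sig t₁ t₂ ≤ sig t₀ t₃
  sig_generate : ⨆ (s : T) (t : T) (_ : s ≤ t), sig s t = mΩ
  shift : T → Ω → Ω
  shift_zero : shift 0 = id
  shift_add : ∀ s t : T, shift (s + t) = shift s ∘ shift t
  shift_measurable : ∀ t : T, Measurable (shift t)
  /-- `θ^τ 𝓕_s^t = 𝓕_{s-τ}^{t-τ}`: since `θ^τ` is a bijection with inverse `θ^{-τ}`, a set is the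
  image under `θ^τ` of a member of `𝓕_s^t` iff its preimage under `θ^τ` belongs to `𝓕_s^t`. -/
  shift_sig : ∀ s t τ : T, s ≤ t → (sig s t).map (shift τ) = sig (s - τ) (t - τ)
  stationary : ∀ t : T, P.map (shift t) = P
  /-- `𝓕_{-∞}^t` and `𝓕_t^∞` are independent under `P`. -/
  memoryless : ∀ t : T, Indep (⨆ (s : T) (_ : s ≤ t), sig s t) (⨆ (u : T) (_ : t ≤ u), sig t u) P

/-- A (right-continuous, adapted) random dynamical system on `X` over a memoryless noise. -/
structure RandomDynSys {T : AddSubgroup ℝ} {Ω : Type*} [MeasurableSpace Ω] {P : Measure Ω}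
    (N : MemorylessNoise T Ω P) (X : Type*) [TopologicalSpace X] [MeasurableSpace X] where
  φ : NonnegTime T → Ω → X → X
  continuous_space : ∀ t ω, Continuous (φ t ω)
  adapted : ∀ (t : NonnegTime T) (x : X), @Measurable Ω X (N.sig 0 t) _ (fun ω => φ t ω x)
  map_zero : ∀ ω x, φ 0 ω x = x
  cocycle : ∀ (s t : NonnegTime T) (ω : Ω) (x : X),
    φ (s + t) ω x = φ t (N.shift s ω) (φ s ω x)
  right_continuous : ∀ (ω : Ω) (u : ℕ → NonnegTime T) (t : NonnegTime T) (z : ℕ → X) (x : X),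
    Antitone u → Tendsto u atTop (𝓝 t) → Tendsto z atTop (𝓝 x) →
      Tendsto (fun n => φ (u n) ω (z n)) atTop (𝓝 (φ t ω x))

namespace RandomDynSys

section Markov

variable {T : AddSubgroup ℝ} {Ω : Type*} [MeasurableSpace Ω] {P : Measure Ω}
  {N : MemorylessNoise T Ω P} {X : Type*} [TopologicalSpace X] [MeasurableSpace X]
  (S : RandomDynSys N X)

/-- The Markov transition probability `φ_x^t(A) = P(ω : φ(t,ω)x ∈ A)`. -/
noncomputable def transition (t : NonnegTime T) (x : X) : Measure X :=
  P.map (fun ω => S.φ t ω x)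

/-- `ρ` is stationary for the Markov transition probabilities. -/
def IsStationary (ρ : Measure X) : Prop :=
  ∀ (t : NonnegTime T) (A : Set X), MeasurableSet A → ∫⁻ x, S.transition t x A ∂ρ = ρ A

/-- `ρ` is ergodic for the Markov transition probabilities: it is stationary, and every
almost invariant Borel set has measure `0` or `1`. -/
def IsErgodic (ρ : Measure X) : Prop :=
  S.IsStationary ρ ∧
    ∀ A : Set X, MeasurableSet A →
      (∀ t : NonnegTime T, ∀ᵐ x ∂ρ, S.transition t x A = A.indicator 1 x) → ρ A = 0 ∨ ρ A = 1

/-- The set `A_ρ` of `ρ`-transitive points. -/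
def transitivePoints (ρ : Measure X) : Set X :=
  {x | x ∈ ρ.support ∧ ∀ U : Set X, IsOpen U → 0 < ρ U →
    0 < P {ω | ∃ t : NonnegTime T, S.φ t ω x ∈ U}}

/-- The set of pairs `(x,y)` that are contractible towards the set `A`: for every neighbourhood
`V` of the diagonal `Δ_A`, the pair visits `V` with positive probability. -/
def contractibleToSet (A : Set X) : Set (X × X) :=
  {q | ∀ V ∈ 𝓝ˢ ((fun a : X => (a, a)) '' A),
    0 < P {ω | ∃ t : NonnegTime T, (S.φ t ω q.1, S.φ t ω q.2) ∈ V}}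

end Markov

section Metric

variable {T : AddSubgroup ℝ} {Ω : Type*} [MeasurableSpace Ω] {P : Measure Ω}
  {N : MemorylessNoise T Ω P} {X : Type*} [MetricSpace X] [MeasurableSpace X]
  (S : RandomDynSys N X)

/-- The set of pairs `(x,y)` that are contractible towards the point `p`. -/
def contractibleToPoint (p : X) : Set (X × X) :=
  {q | ∀ ε : ℝ, 0 < ε →
    0 < P {ω | ∃ t : NonnegTime T,
      (S.φ t ω q.1, S.φ t ω q.2) ∈ Metric.ball p ε ×ˢ Metric.ball p ε}}

/-- `A` contracts under `ω`: `diam (φ(t,ω)A) → 0` as `t → ∞` (the diameter is taken in `[0,∞]`). -/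
def Contracts (ω : Ω) (A : Set X) : Prop :=
  Tendsto (fun t : NonnegTime T => Metric.ediam (S.φ t ω '' A)) atTop (𝓝 0)

/-- `A` admits stable trajectories. -/
def AdmitsStableTrajectories (A : Set X) : Prop :=
  0 < P {ω | ∃ U : Set X, IsOpen U ∧ (U ∩ A).Nonempty ∧ S.Contracts ω U}

/-- The system is stable with respect to `ρ`: the support of `ρ` admits stable trajectories. -/
def IsStable (ρ : Measure X) : Prop :=
  S.AdmitsStableTrajectories ρ.support

/-- The open set `U` is σ-contracting under `ω`. -/
def SigmaContracts (ω : Ω) (U : Set X) : Prop :=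
  ∃ V : ℕ → Set X, Monotone V ∧ (∀ i, IsOpen (V i)) ∧ U = ⋃ i, V i ∧ ∀ i, S.Contracts ω (V i)

/-- The system is `ρ`-almost everywhere stably synchronising. -/
def IsAEStablySynchronising (ρ : Measure X) : Prop :=
  ∀ᵐ ω ∂P, ∃ U : Set X, IsOpen U ∧ ρ U = 1 ∧ S.SigmaContracts ω U

/-- `n` is a number of synchronising regions for `ρ`: for almost every `ω` there are `n` open
σ-contracting sets of `ρ`-measure `1/n`, such that trajectories starting in different ones of
these sets do not synchronise. -/
def IsSyncNumber (ρ : Measure X) (n : ℕ) : Prop :=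
  0 < n ∧ ∀ᵐ ω ∂P, ∃ U : Fin n → Set X,
    (∀ i, IsOpen (U i) ∧ ρ (U i) = (n : ENNReal)⁻¹ ∧ S.SigmaContracts ω (U i)) ∧
    ∀ i j, i < j → ∀ x ∈ U i, ∀ y ∈ U j,
      ¬ Tendsto (fun t : NonnegTime T => dist (S.φ t ω x) (S.φ t ω y)) atTop (𝓝 0)

end Metric

end RandomDynSys

/-- `C` contains a `ρ`-full-length rectangle. -/
def ContainsFullLengthRectangle {X : Type*} [MeasurableSpace X] (ρ : Measure X)
    (C : Set (X × X)) : Prop :=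
  ∃ A₁ A₂ : Set X, MeasurableSet A₁ ∧ MeasurableSet A₂ ∧ 0 < ρ A₁ ∧ ρ A₂ = 1 ∧ A₁ ×ˢ A₂ ⊆ C

/-!
Let `x ~ y` mean that the trajectories of `x` and `y` synchronise under a given realisation of the
noise, and let `s(x, y)` be the probability of `x ~ y`. The statements are linked in the circle
(i) → (ii) → (iii) → (iv) → (i); that (iii) and (v) are the same is immediate.

Only the future of the noise matters, so the system is first regarded as a `ForwardSystem`: the
shift `θ^t`, `t ≥ 0`, is independent of the events `F t` observable up to time `t`, and these
generate the σ-algebra. Two tools carry the argument. One is Lévy's zero-one law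
(`tendstoInMeasure_condProb`): the conditional probability, given the present state, of an event
invariant under the dynamics tends to the indicator of the event. Applied to one trajectory it gives
the other tool, the ergodicity of the skew product `(x, ω) ↦ (φ(t,ω)x, θ^t ω)`
(`Ergodic.skew_zero_or_one`). From ergodicity come recurrence (`Ergodic.ae_recurrent`), the
transitivity of almost all points, and, under stability, a contracting neighbourhood of almost every
point (`Ergodic.ae_exists_contracting_nhd`).

The core is (ii) → (iii). A transitive point reaches a set that contracts with positive probability,
hence has itself a neighbourhood contracting with positive probability. So if `(x, y)` is
contractible towards the transitive points, then `s` is bounded below by a positive constant near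
`(x, y)` (`eventually_le_prob_sync`), and uniformly so on compact sets `K × K₂` inside the
full-length rectangle. Here `ρ(K) > 0`, and `K₂` may have mass as near to `1` as desired, because `X`
is Borel in its completion. By stationarity `y` is in `K₂` at time `t` with probability close to `1`.
If moreover `x` is then in `K`, the value of `s` at the pair is bounded below, whereas Lévy's law
applied to pairs makes it tend to `0` unless `x ~ y`. Hence, as `t → ∞`, it becomes improbable that
`x` is in `K` at time `t` without `x ~ y` (`Ergodic.tendsto_mem_not_sync`). But almost every
trajectory visits `K`, with high probability at one of finitely many times, and by stationarity of
the skew product the same holds for these times shifted by any `n`. So almost all pairs synchronise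
(`Ergodic.ae_sync`). The union of the contracting basic open sets of positive measure is then
σ-contracting and of full measure (`exists_sigmaContracting_of_ae_sync`).

For (iii) → (iv), one of two typical trajectories is recurrent and the other approaches it. The
implications (iv) → (i) and (i) → (ii) only use that the support and the transitive points have full
measure. For the uniqueness of the number of synchronising regions, compare two families of regions
for one realisation: every region of one family meets some region of the other, and no two of them
meet the same one, as they would then synchronise (`card_le_of_sync_regions`).
-/

set_option linter.unusedSectionVars false

/-! ### Time -/

namespace NonnegTime

variable {T : AddSubgroup ℝ}

/-- The rational non-negative times. -/
def rat (T : AddSubgroup ℝ) : Set (NonnegTime T) := {t | ∃ r : ℚ, ((t : T) : ℝ) = r}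

lemma countable_rat : (rat T).Countable := by
  have h : rat T ⊆ (fun t : NonnegTime T => ((t : T) : ℝ)) ⁻¹' range ((↑) : ℚ → ℝ) := by
    rintro t ⟨r, hr⟩
    exact ⟨r, hr.symm⟩
  exact ((countable_range _).preimage
    (Subtype.val_injective.comp Subtype.val_injective)).mono h

lemma add_mem_rat {s t : NonnegTime T} (hs : s ∈ rat T) (ht : t ∈ rat T) : s + t ∈ rat T := by
  obtain ⟨r, hr⟩ := hs
  obtain ⟨r', hr'⟩ := ht
  exact ⟨r + r', by push_cast; rw [← hr, ← hr']⟩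

lemma zero_mem_rat : (0 : NonnegTime T) ∈ rat T := ⟨0, by simp⟩

lemma le_add_time (s t : NonnegTime T) : s ≤ s + t := le_add_of_nonneg_right t.2

lemma exists_eq_add_of_le {s t : NonnegTime T} (h : s ≤ t) : ∃ u, t = s + u :=
  ⟨⟨t.1 - s.1, sub_nonneg.2 h⟩, Subtype.ext (by simp)⟩

lemma tendsto_add_atTop_iff {α : Type*} {l : Filter α} (f : NonnegTime T → α) (s : NonnegTime T) :
    Tendsto (fun t => f (s + t)) atTop l ↔ Tendsto f atTop l := by
  have key : map (fun t => s + t) (atTop : Filter (NonnegTime T)) = atTop := by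
    refine le_antisymm (tendsto_atTop_mono (fun t => ?_) tendsto_id) fun A hA => ?_
    · rw [add_comm]; exact le_add_time t s
    · obtain ⟨a, ha⟩ := mem_atTop_sets.1 (mem_map.1 hA)
      refine mem_atTop_sets.2 ⟨s + a, fun b hb => ?_⟩
      obtain ⟨u, rfl⟩ := exists_eq_add_of_le hb
      rw [add_assoc]
      exact ha _ (le_add_time a u)
  conv_rhs => rw [← key]
  rw [tendsto_map'_iff]
  rfl

/-- Every time of `ℤ` or `ℝ` is approached from the right by rational times. -/
lemma exists_antitone_rat_tendsto (hT : T = AddSubgroup.zmultiples 1 ∨ T = ⊤)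
    (t : NonnegTime T) :
    ∃ u : ℕ → NonnegTime T, Antitone u ∧ (∀ n, u n ∈ rat T) ∧ Tendsto u atTop (𝓝 t) := by
  rcases hT with rfl | rfl
  · refine ⟨fun _ => t, antitone_const, fun _ => ?_, tendsto_const_nhds⟩
    obtain ⟨k, hk⟩ := AddSubgroup.mem_zmultiples_iff.1 t.1.2
    exact ⟨k, by simp [← hk]⟩
  · obtain ⟨u, hu, hlt, hlim⟩ := Real.exists_seq_rat_strictAnti_tendsto ((t.1 : ℝ))
    have h0 : (0 : ℝ) ≤ (t.1 : ℝ) := t.2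
    refine ⟨fun n => ⟨⟨u n, trivial⟩, h0.trans (hlt n).le⟩, fun m n h => ?_, fun n => ⟨u n, rfl⟩, ?_⟩
    · have := hu.antitone h
      change ((u n : ℚ) : ℝ) ≤ u m
      exact_mod_cast this
    · rw [tendsto_subtype_rng, tendsto_subtype_rng]
      exact hlim

/-- The integers among the times. -/
def ofNat (h1 : (1 : ℝ) ∈ T) (n : ℕ) : NonnegTime T :=
  ⟨n • ⟨1, h1⟩, nsmul_nonneg (show (0 : ℝ) ≤ 1 from zero_le_one) n⟩

lemma coe_ofNat (h1 : (1 : ℝ) ∈ T) (n : ℕ) : ((ofNat h1 n : T) : ℝ) = n := by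
  simp [ofNat]

lemma ofNat_mem_rat (h1 : (1 : ℝ) ∈ T) (n : ℕ) : ofNat h1 n ∈ rat T := ⟨n, by simp [coe_ofNat]⟩

lemma monotone_ofNat (h1 : (1 : ℝ) ∈ T) : Monotone (ofNat h1) := by
  intro m n h
  change ((ofNat h1 m : T) : ℝ) ≤ (ofNat h1 n : T)
  rw [coe_ofNat, coe_ofNat]
  exact_mod_cast h

lemma exists_le_ofNat (h1 : (1 : ℝ) ∈ T) (t : NonnegTime T) : ∃ n, t ≤ ofNat h1 n := by
  obtain ⟨n, hn⟩ := exists_nat_ge ((t : T) : ℝ)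
  refine ⟨n, ?_⟩
  change ((t : T) : ℝ) ≤ (ofNat h1 n : T)
  rwa [coe_ofNat]

lemma tendsto_ofNat (h1 : (1 : ℝ) ∈ T) : Tendsto (ofNat h1) atTop atTop :=
  tendsto_atTop_atTop_of_monotone (monotone_ofNat h1) (exists_le_ofNat h1)

end NonnegTime

/-! ### Systems over a one-sided noise -/

/-- A random dynamical system over a one-sided memoryless noise: `F t` is the σ-algebra of events
observable up to time `t`, these σ-algebras generate the whole σ-algebra of `Ω`, and the shift `θ t`
preserves `P` and is independent of `F t`. A system over a two-sided noise becomes one of this kind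
when `Ω` is given the σ-algebra generated by the future. -/
structure ForwardSystem (T : AddSubgroup ℝ) (Ω : Type*) [mΩ : MeasurableSpace Ω] (P : Measure Ω)
    (X : Type*) [TopologicalSpace X] [MeasurableSpace X] where
  one_mem : (1 : ℝ) ∈ T
  rightDense : ∀ t : NonnegTime T, ∃ u : ℕ → NonnegTime T,
    Antitone u ∧ (∀ n, u n ∈ NonnegTime.rat T) ∧ Tendsto u atTop (𝓝 t)
  F : NonnegTime T → MeasurableSpace Ω
  F_mono : Monotone F
  F_le : ∀ t, F t ≤ mΩ
  iSup_F : ⨆ t, F t = mΩ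
  θ : NonnegTime T → Ω → Ω
  measurePreserving : ∀ t, MeasurePreserving (θ t) P P
  indep : ∀ t, Indep (F t) (mΩ.comap (θ t)) P
  φ : NonnegTime T → Ω → X → X
  continuous_space : ∀ t ω, Continuous (φ t ω)
  adapted : ∀ t x, Measurable[F t] (fun ω => φ t ω x)
  map_zero : ∀ ω x, φ 0 ω x = x
  cocycle : ∀ s t ω x, φ (s + t) ω x = φ t (θ s ω) (φ s ω x)
  right_continuous : ∀ (ω : Ω) (u : ℕ → NonnegTime T) (t : NonnegTime T) (z : ℕ → X) (x : X),
    Antitone u → Tendsto u atTop (𝓝 t) → Tendsto z atTop (𝓝 x) →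
      Tendsto (fun n => φ (u n) ω (z n)) atTop (𝓝 (φ t ω x))

namespace ForwardSystem

open NonnegTime

section Levy

variable {T : AddSubgroup ℝ} {Ω : Type*} [mΩ : MeasurableSpace Ω] {P : Measure Ω}
  [IsProbabilityMeasure P] {X : Type*} [TopologicalSpace X] [MeasurableSpace X]
  (D : ForwardSystem T Ω P X)

/-- Integrating a function of a variable known at time `t` and of the noise after time `t`, the
latter may be replaced by an independent copy. -/
lemma setLIntegral_shift {Z : Type*} [MeasurableSpace Z] (t : NonnegTime T) {z : Ω → Z}
    (hz : Measurable[D.F t] z) {A : Set Ω} (hA : MeasurableSet[D.F t] A)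
    {g : Z × Ω → ENNReal} (hg : Measurable g) :
    ∫⁻ ω in A, g (z ω, D.θ t ω) ∂P = ∫⁻ ω in A, ∫⁻ ω', g (z ω, ω') ∂P ∂P := by
  have ha : Measurable[D.F t] (fun ω => (z ω, ω ∈ A)) :=
    Measurable.prodMk hz (@measurableSet_setOfPred _ (D.F t) (· ∈ A) |>.1 hA)
  have ha' := ha.mono (D.F_le t) le_rfl
  have hA' := D.F_le t _ hA
  have hθ := (D.measurePreserving t).measurable
  have hind : IndepFun (fun ω => (z ω, ω ∈ A)) (D.θ t) P :=
    (IndepFun_iff_Indep _ _ _).2 (indep_of_indep_of_le_left (D.indep t) ha.comap_le)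
  have hprod := (indepFun_iff_map_prod_eq_prod_map_map ha'.aemeasurable hθ.aemeasurable).1 hind
  rw [(D.measurePreserving t).map_eq] at hprod
  have hS : MeasurableSet {p : (Z × Prop) × Ω | p.1.2} :=
    measurableSet_setOfPred.2 (measurable_snd.comp measurable_fst)
  have hh : Measurable ({p : (Z × Prop) × Ω | p.1.2}.indicator fun p => g (p.1.1, p.2)) :=
    (hg.comp (by fun_prop)).indicator hS
  have e1 : ∫⁻ ω in A, g (z ω, D.θ t ω) ∂P
      = ∫⁻ p, {p : (Z × Prop) × Ω | p.1.2}.indicator (fun p => g (p.1.1, p.2)) p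
        ∂(P.map fun ω => ((z ω, ω ∈ A), D.θ t ω)) := by
    rw [lintegral_map hh (ha'.prodMk hθ), ← lintegral_indicator hA']
    rfl
  rw [e1, hprod, lintegral_prod _ hh.aemeasurable,
    lintegral_map hh.lintegral_prod_right' ha', ← lintegral_indicator hA']
  refine lintegral_congr fun ω => ?_
  by_cases hω : ω ∈ A <;> simp [Set.indicator, hω]

/-- **Lévy's zero-one law** for the process `z`: let `B` be the event that at time `u n` the process
and the remaining noise lie in `E`, whatever `n` is. Then the conditional probability of `B` given
`z n` tends to the indicator of `B`. -/
lemma tendstoInMeasure_condProb {Z : Type*} [MeasurableSpace Z] {E : Set (Z × Ω)}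
    (hE : MeasurableSet E) {u : ℕ → NonnegTime T} (hu : Monotone u) (hu' : Tendsto u atTop atTop)
    {z : ℕ → Ω → Z} (hz : ∀ n, Measurable[D.F (u n)] (z n)) {B : Set Ω} (hB : MeasurableSet B)
    (hBE : ∀ n, ∀ᵐ ω ∂P, ω ∈ B ↔ (z n ω, D.θ (u n) ω) ∈ E) :
    TendstoInMeasure P (fun n ω => P.real {ω' | (z n ω, ω') ∈ E}) atTop (B.indicator 1) := by
  let ℱ : Filtration ℕ mΩ :=
    { seq := fun n => D.F (u n)
      mono' := fun _ _ h => D.F_mono (hu h)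
      le' := fun n => D.F_le _ }
  have hsup : ⨆ n, ℱ n = mΩ := by
    refine le_antisymm (iSup_le fun n => ℱ.le n) ?_
    refine D.iSup_F.symm.trans_le (iSup_le fun t => ?_)
    obtain ⟨n, hn⟩ := (hu'.eventually_ge_atTop t).exists
    exact (D.F_mono hn).trans (le_iSup ℱ n)
  have hint : Integrable (B.indicator (1 : Ω → ℝ)) P := (integrable_const 1).indicator hB
  have hf : Measurable fun x : Z => P {ω' | (x, ω') ∈ E} := measurable_measure_prodMk_left hE
  have hcond : ∀ n, (fun ω => P.real {ω' | (z n ω, ω') ∈ E}) =ᵐ[P] P[B.indicator 1 | ℱ n] := by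
    intro n
    have hm : Measurable[ℱ n] fun ω => P {ω' | (z n ω, ω') ∈ E} := hf.comp (hz n)
    have hm' := hm.mono (ℱ.le n) le_rfl
    have hbd : ∀ ω, ‖P.real {ω' | (z n ω, ω') ∈ E}‖ ≤ 1 := fun ω => by
      rw [Real.norm_of_nonneg measureReal_nonneg]; exact measureReal_le_one
    have hI : Integrable (fun ω => P.real {ω' | (z n ω, ω') ∈ E}) P :=
      Integrable.of_bound hm'.ennreal_toReal.aestronglyMeasurable 1 (ae_of_all _ hbd)
    refine ae_eq_condExp_of_forall_setIntegral_eq (ℱ.le n) hint (fun _ _ _ => hI.integrableOn)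
      (fun A hA _ => ?_) hm.ennreal_toReal.stronglyMeasurable.aestronglyMeasurable
    have hA' := ℱ.le n _ hA
    have h1 := D.setLIntegral_shift (u n) (hz n) hA
      (g := E.indicator 1) ((measurable_const (a := (1 : ENNReal))).indicator hE)
    have h2 : ∀ ω, ∫⁻ ω', E.indicator 1 (z n ω, ω') ∂P = P {ω' | (z n ω, ω') ∈ E} := fun ω => by
      have : MeasurableSet {ω' | (z n ω, ω') ∈ E} := measurable_prodMk_left hE
      rw [← lintegral_indicator_one this]
      rfl
    simp_rw [h2] at h1
    have h3 : ∫⁻ ω in A, E.indicator 1 (z n ω, D.θ (u n) ω) ∂P = P (B ∩ A) := by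
      rw [← Measure.restrict_apply hB, ← lintegral_indicator_one hB]
      refine lintegral_congr_ae (ae_restrict_of_ae ?_)
      filter_upwards [hBE n] with ω hω
      by_cases h : ω ∈ B
      · simp [h, hω.1 h]
      · simp [h, mt hω.2 h]
    rw [integral_indicator_one hB, measureReal_restrict_apply hB, measureReal_def, ← h3, h1]
    exact integral_toReal hm'.aemeasurable (ae_of_all _ fun ω => measure_lt_top _ _)
  have hlim := tendsto_ae_condExp (μ := P) (ℱ := ℱ) (B.indicator (1 : Ω → ℝ))
  rw [hsup, condExp_of_stronglyMeasurable le_rfl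
    (measurable_one.indicator hB).stronglyMeasurable hint] at hlim
  refine tendstoInMeasure_of_tendsto_ae (fun n => ?_) ?_
  · exact (stronglyMeasurable_condExp.mono (ℱ.le n)).aestronglyMeasurable.congr (hcond n).symm
  · filter_upwards [hlim, ae_all_iff.2 hcond] with ω h1 h2
    exact h1.congr fun n => (h2 n).symm

end Levy

end ForwardSystem

namespace ForwardSystem

open NonnegTime

/-! ### The skew product -/

section Skew

variable {T : AddSubgroup ℝ} {Ω : Type*} [mΩ : MeasurableSpace Ω] {P : Measure Ω}
  {X : Type*} [MetricSpace X] [SecondCountableTopology X] [MeasurableSpace X] [BorelSpace X]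
  (D : ForwardSystem T Ω P X)

lemma measurable_φ_apply (t : NonnegTime T) (x : X) : Measurable fun ω => D.φ t ω x :=
  (D.adapted t x).mono (D.F_le t) le_rfl

lemma measurable_φ (t : NonnegTime T) : Measurable fun p : X × Ω => D.φ t p.2 p.1 :=
  measurable_uncurry_of_continuous_of_measurable (u := fun x ω => D.φ t ω x)
    (fun ω => D.continuous_space t ω) (fun x => D.measurable_φ_apply t x)

/-- The skew product map `(x, ω) ↦ (φ(t,ω)x, θ^t ω)`. -/
def skew (t : NonnegTime T) (p : X × Ω) : X × Ω := (D.φ t p.2 p.1, D.θ t p.2)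

lemma measurable_skew (t : NonnegTime T) : Measurable (D.skew t) :=
  (D.measurable_φ t).prodMk ((D.measurePreserving t).measurable.comp measurable_snd)

/-- The ergodicity of a measure for the Markov kernels `(t, x) ↦ P(φ(t,·)x ∈ ·)`. -/
structure Ergodic (ρ : Measure X) : Prop where
  stationary : ∀ (t : NonnegTime T) (A : Set X), MeasurableSet A →
    ∫⁻ x, P {ω | D.φ t ω x ∈ A} ∂ρ = ρ A
  zero_or_one : ∀ A : Set X, MeasurableSet A →
    (∀ t : NonnegTime T, ∀ᵐ x ∂ρ, P {ω | D.φ t ω x ∈ A} = A.indicator 1 x) → ρ A = 0 ∨ ρ A = 1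

variable {D} [IsProbabilityMeasure P] {ρ : Measure X} [IsProbabilityMeasure ρ]

lemma Ergodic.measurePreserving_φ (h : D.Ergodic ρ) (t : NonnegTime T) :
    MeasurePreserving (fun p : X × Ω => D.φ t p.2 p.1) (ρ.prod P) ρ := by
  refine ⟨D.measurable_φ t, Measure.ext fun A hA => ?_⟩
  rw [Measure.map_apply (D.measurable_φ t) hA, Measure.prod_apply (D.measurable_φ t hA),
    ← h.stationary t A hA]
  rfl

lemma measure_skew_mem (t : NonnegTime T) (x : X) {E : Set (X × Ω)} (hE : MeasurableSet E) :
    P {ω | D.skew t (x, ω) ∈ E} = ∫⁻ ω, P {ω' | (D.φ t ω x, ω') ∈ E} ∂P := by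
  have h1 := D.setLIntegral_shift t (D.adapted t x) MeasurableSet.univ
    (g := E.indicator 1) (measurable_one.indicator hE)
  simp only [Measure.restrict_univ] at h1
  have h2 : ∀ y : X, ∫⁻ ω', E.indicator 1 (y, ω') ∂P = P {ω' | (y, ω') ∈ E} := fun y => by
    have : MeasurableSet {ω' | (y, ω') ∈ E} := measurable_prodMk_left hE
    rw [← lintegral_indicator_one this]
    rfl
  simp_rw [h2] at h1
  have h3 : MeasurableSet {ω | D.skew t (x, ω) ∈ E} :=
    ((D.measurable_skew t).comp measurable_prodMk_left) hE
  rw [← h1, ← lintegral_indicator_one h3]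
  rfl

lemma Ergodic.measurePreserving_skew (h : D.Ergodic ρ) (t : NonnegTime T) :
    MeasurePreserving (D.skew t) (ρ.prod P) (ρ.prod P) := by
  refine ⟨D.measurable_skew t, Measure.ext fun E hE => ?_⟩
  rw [Measure.map_apply (D.measurable_skew t) hE, Measure.prod_apply (D.measurable_skew t hE)]
  have hf : Measurable fun x : X => P {ω' | (x, ω') ∈ E} := measurable_measure_prodMk_left hE
  calc ∫⁻ x, P {ω | D.skew t (x, ω) ∈ E} ∂ρ
      = ∫⁻ x, ∫⁻ ω, P {ω' | (D.φ t ω x, ω') ∈ E} ∂P ∂ρ :=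
        lintegral_congr fun x => measure_skew_mem t x hE
    _ = ∫⁻ p, P {ω' | (D.φ t p.2 p.1, ω') ∈ E} ∂(ρ.prod P) :=
        (lintegral_prod _ (hf.comp (D.measurable_φ t)).aemeasurable).symm
    _ = ∫⁻ x, P {ω' | (x, ω') ∈ E} ∂ρ := (h.measurePreserving_φ t).lintegral_comp hf
    _ = ρ.prod P E := (Measure.prod_apply hE).symm

/-- A set invariant at all rational times is invariant at all times: approximate its indicator in
`L¹` by a bounded continuous function, along whose trajectories right-continuity applies. -/
lemma Ergodic.invariant_of_rat (h : D.Ergodic ρ) {A : Set X} (hA : MeasurableSet A)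
    (hq : ∀ q ∈ rat T, ∀ᵐ p ∂ρ.prod P, D.φ q p.2 p.1 ∈ A ↔ p.1 ∈ A) (t : NonnegTime T) :
    ∀ᵐ p ∂ρ.prod P, D.φ t p.2 p.1 ∈ A ↔ p.1 ∈ A := by
  set f : X → ℝ := A.indicator 1 with hf
  have hfm : Measurable f := measurable_one.indicator hA
  have hφ := fun s => D.measurable_φ s
  obtain ⟨u, huanti, hurat, hu⟩ := D.rightDense t
  have hfu : ∀ n, ∀ᵐ p ∂ρ.prod P, f (D.φ (u n) p.2 p.1) = f p.1 := fun n => by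
    filter_upwards [hq _ (hurat n)] with p hp
    by_cases hpA : p.1 ∈ A
    · simp [hf, hpA, hp.2 hpA]
    · simp [hf, hpA, mt hp.1 hpA]
  have key : ∀ ε : ENNReal, ε ≠ 0 →
      ∫⁻ p, ‖f (D.φ t p.2 p.1) - f p.1‖ₑ ∂ρ.prod P ≤ ε + ε := by
    intro ε hε
    obtain ⟨g, hg, -⟩ := Integrable.exists_boundedContinuous_lintegral_sub_le
      (μ := ρ) (f := f) ((integrable_const 1).indicator hA) hε
    have hgm : Measurable g := g.continuous.measurable
    have hlim : Tendsto (fun n => ∫⁻ p, ‖g (D.φ t p.2 p.1) - g (D.φ (u n) p.2 p.1)‖ₑ ∂ρ.prod P)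
        atTop (𝓝 (∫⁻ _, 0 ∂ρ.prod P)) := by
      refine tendsto_lintegral_of_dominated_convergence (fun _ => ENNReal.ofReal (2 * ‖g‖))
        (fun n => ((hgm.comp (hφ t)).sub (hgm.comp (hφ (u n)))).enorm) (fun n => ?_) ?_ ?_
      · refine ae_of_all _ fun p => ?_
        change ‖g (D.φ t p.2 p.1) - g (D.φ (u n) p.2 p.1)‖ₑ ≤ _
        rw [← ofReal_norm, ← dist_eq_norm]
        exact ENNReal.ofReal_le_ofReal (g.dist_le_two_norm _ _)
      · simpa using ENNReal.mul_ne_top ENNReal.ofNat_ne_top enorm_ne_top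
      · refine ae_of_all _ fun p => ?_
        have h1 := D.right_continuous p.2 u t (fun _ => p.1) p.1 huanti hu tendsto_const_nhds
        have h2 := ((tendsto_const_nhds (x := g (D.φ t p.2 p.1))).sub
          ((g.continuous.tendsto _).comp h1)).enorm
        simpa using h2
    have hdist : ∀ s, ∫⁻ p, ‖f (D.φ s p.2 p.1) - g (D.φ s p.2 p.1)‖ₑ ∂ρ.prod P ≤ ε := fun s => by
      rw [(h.measurePreserving_φ s).lintegral_comp (f := fun x => ‖f x - g x‖ₑ)
        (hfm.sub hgm).enorm]
      exact hg
    have hn : ∀ n, ∫⁻ p, ‖f (D.φ t p.2 p.1) - f p.1‖ₑ ∂ρ.prod P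
        ≤ ε + ∫⁻ p, ‖g (D.φ t p.2 p.1) - g (D.φ (u n) p.2 p.1)‖ₑ ∂ρ.prod P + ε := by
      intro n
      refine le_trans ?_ (add_le_add (add_le_add_left (hdist t) _) (hdist (u n)))
      have hm : ∀ s, Measurable fun p : X × Ω => ‖f (D.φ s p.2 p.1) - g (D.φ s p.2 p.1)‖ₑ :=
        fun s => ((hfm.comp (hφ s)).sub (hgm.comp (hφ s))).enorm
      rw [← lintegral_add_left (hm t), ← lintegral_add_right _ (hm (u n))]
      refine lintegral_mono_ae ?_
      filter_upwards [hfu n] with p hp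
      rw [← hp, ← edist_eq_enorm_sub, ← edist_eq_enorm_sub, ← edist_eq_enorm_sub,
        ← edist_eq_enorm_sub, edist_comm (f (D.φ (u n) p.2 p.1)) (g _)]
      exact (edist_triangle _ (g (D.φ (u n) p.2 p.1)) _).trans
        (add_le_add_left (edist_triangle _ _ _) _)
    have hlim' := (hlim.const_add ε).add_const ε
    simp only [lintegral_zero, add_zero] at hlim'
    exact ge_of_tendsto' hlim' hn
  have hzero : ∫⁻ p, ‖f (D.φ t p.2 p.1) - f p.1‖ₑ ∂ρ.prod P = 0 := by
    refine le_antisymm (ENNReal.le_of_forall_pos_le_add fun ε hε _ => ?_) bot_le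
    refine (key (ε / 2) (by simpa using hε.ne')).trans ?_
    rw [ENNReal.add_halves, zero_add]
  have hm : Measurable fun p : X × Ω => ‖f (D.φ t p.2 p.1) - f p.1‖ₑ :=
    ((hfm.comp (hφ t)).sub (hfm.comp measurable_fst)).enorm
  rw [lintegral_eq_zero_iff hm] at hzero
  filter_upwards [hzero] with p hp
  have hp' : f (D.φ t p.2 p.1) = f p.1 := by simpa [sub_eq_zero] using hp
  by_cases h1 : D.φ t p.2 p.1 ∈ A <;> by_cases h2 : p.1 ∈ A <;> simp [hf, h1, h2] at hp' ⊢

/-- Ergodicity of the skew product: a set of pairs `(x, ω)` that contains its preimages under the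
skew product has measure `0` or `1`. By Lévy's law the conditional probability of the set given
`x` takes almost surely only the values `0` and `1`, and where it is `1` is an invariant set. -/
lemma Ergodic.skew_zero_or_one (h : D.Ergodic ρ) {E : Set (X × Ω)} (hE : MeasurableSet E)
    (hsub : ∀ q ∈ rat T, ∀ p, D.skew q p ∈ E → p ∈ E) :
    ρ.prod P E = 0 ∨ ρ.prod P E = 1 := by
  have hiff : ∀ q ∈ rat T, ∀ᵐ p ∂ρ.prod P, D.skew q p ∈ E ↔ p ∈ E := by
    intro q hq
    have hm := h.measurePreserving_skew q
    have : D.skew q ⁻¹' E =ᵐ[ρ.prod P] E :=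
      ae_eq_of_subset_of_measure_ge (hsub q hq) (hm.measure_preimage hE.nullMeasurableSet).ge
        (hm.measurable hE).nullMeasurableSet (measure_ne_top _ _)
    filter_upwards [this] with p hp
    exact iff_of_eq hp
  set f : X → ENNReal := fun x => P {ω | (x, ω) ∈ E} with hf
  have hfm : Measurable f := measurable_measure_prodMk_left hE
  have hf1 : ∀ x, f x ≤ 1 := fun x => prob_le_one
  have hsec : ∀ x, MeasurableSet {ω | (x, ω) ∈ E} := fun x => measurable_prodMk_left hE
  -- the conditional probability `f` is separated from `0` and from `1` with probability zero
  have hsep : ∀ ε : ℝ, 0 < ε → ρ {x | ε ≤ (f x).toReal ∧ ε ≤ 1 - (f x).toReal} = 0 := by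
    intro ε hε
    set C := {x | ε ≤ (f x).toReal ∧ ε ≤ 1 - (f x).toReal} with hC
    have hCm : MeasurableSet C :=
      (measurableSet_le measurable_const hfm.ennreal_toReal).inter
        (measurableSet_le measurable_const (measurable_const.sub hfm.ennreal_toReal))
    let u := NonnegTime.ofNat D.one_mem
    have hlim : Tendsto (fun n => ∫⁻ x, P {ω | D.φ (u n) ω x ∈ C} ∂ρ) atTop
        (𝓝 (∫⁻ _, 0 ∂ρ)) := by
      refine tendsto_lintegral_of_dominated_convergence (fun _ => 1)
        (fun n => measurable_measure_prodMk_left (D.measurable_φ (u n) hCm))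
        (fun n => ae_of_all _ fun x => prob_le_one) (by simp) ?_
      have hae : ∀ᵐ x ∂ρ, ∀ n, ∀ᵐ ω ∂P, D.skew (u n) (x, ω) ∈ E ↔ (x, ω) ∈ E :=
        ae_all_iff.2 fun n => Measure.ae_ae_of_ae_prod (hiff _ (ofNat_mem_rat _ n))
      filter_upwards [hae] with x hx
      have hL := D.tendstoInMeasure_condProb hE (monotone_ofNat D.one_mem)
        (tendsto_ofNat D.one_mem) (z := fun n ω => D.φ (u n) ω x) (fun n => D.adapted (u n) x)
        (hsec x) (fun n => (hx n).mono fun ω hω => hω.symm)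
      refine tendsto_of_tendsto_of_tendsto_of_le_of_le tendsto_const_nhds
        (hL (ENNReal.ofReal ε) (by simpa using hε)) (fun _ => bot_le)
        fun n => measure_mono fun ω hω => ?_
      have hω' : ε ≤ (f (D.φ (u n) ω x)).toReal ∧ ε ≤ 1 - (f (D.φ (u n) ω x)).toReal := hω
      change ENNReal.ofReal ε ≤ edist ((f (D.φ (u n) ω x)).toReal) _
      rw [edist_dist]
      refine ENNReal.ofReal_le_ofReal ?_
      rw [Real.dist_eq]
      by_cases hxω : (x, ω) ∈ E
      · rw [indicator_of_mem (by exact hxω), abs_sub_comm]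
        exact hω'.2.trans (le_abs_self _)
      · rw [indicator_of_notMem (by exact hxω), sub_zero]
        exact hω'.1.trans (le_abs_self _)
    simp only [h.stationary _ _ hCm, lintegral_zero] at hlim
    exact tendsto_nhds_unique tendsto_const_nhds hlim
  have h01 : ∀ᵐ x ∂ρ, f x = 0 ∨ f x = 1 := by
    have : ∀ᵐ x ∂ρ, ∀ n : ℕ, ¬ (1 / ((n : ℝ) + 1) ≤ (f x).toReal ∧
        1 / ((n : ℝ) + 1) ≤ 1 - (f x).toReal) :=
      ae_all_iff.2 fun n => measure_eq_zero_iff_ae_notMem.1 (hsep _ Nat.one_div_pos_of_nat)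
    filter_upwards [this] with x hx
    have hfin : f x ≠ ⊤ := (measure_lt_top _ _).ne
    have hle : (f x).toReal ≤ 1 := ENNReal.toReal_le_of_le_ofReal zero_le_one (by simpa using hf1 x)
    by_contra! hcon
    have hpos : 0 < (f x).toReal := ENNReal.toReal_pos hcon.1 hfin
    have hlt : 0 < 1 - (f x).toReal := by
      refine sub_pos.2 (lt_of_le_of_ne hle fun h1 => hcon.2 ?_)
      rw [← ENNReal.ofReal_toReal hfin, h1, ENNReal.ofReal_one]
    obtain ⟨n, hn⟩ := exists_nat_one_div_lt (lt_min hpos hlt)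
    exact hx n ⟨(hn.trans_le (min_le_left _ _)).le, (hn.trans_le (min_le_right _ _)).le⟩
  set A : Set X := {x | f x = 1} with hA
  have hAm : MeasurableSet A := hfm (measurableSet_singleton 1)
  have hinv : ∀ q ∈ rat T, ∀ᵐ p ∂ρ.prod P, D.φ q p.2 p.1 ∈ A ↔ p.1 ∈ A := by
    intro q hq
    rw [Measure.ae_prod_iff_ae_ae (by
      exact ((D.measurable_φ q) hAm).iff (measurable_fst hAm))]
    filter_upwards [h01, Measure.ae_ae_of_ae_prod (hiff q hq)] with x hx hxE
    have hgm : Measurable fun ω => f (D.φ q ω x) := hfm.comp (D.measurable_φ_apply q x)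
    have hint : ∫⁻ ω, f (D.φ q ω x) ∂P = f x := by
      rw [← measure_skew_mem q x hE]
      exact measure_congr (hxE.mono fun ω hω => propext hω)
    rcases hx with hx | hx
    · rw [hx, lintegral_eq_zero_iff hgm] at hint
      filter_upwards [hint] with ω hω
      have hω' : f (D.φ q ω x) = 0 := hω
      simp [hA, hx, hω']
    · have h2 : ∫⁻ ω, (1 - f (D.φ q ω x)) ∂P = 0 := by
        rw [lintegral_sub hgm (by rw [hint, hx]; simp) (ae_of_all _ fun ω => hf1 _), hint, hx]
        simp
      have hm : Measurable fun ω => 1 - f (D.φ q ω x) := measurable_const.sub hgm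
      rw [lintegral_eq_zero_iff hm] at h2
      filter_upwards [h2] with ω hω
      have hω' : 1 - f (D.φ q ω x) = 0 := hω
      simp [hA, hx, le_antisymm (hf1 _) (tsub_eq_zero_iff_le.1 hω')]
  have hmeas : ρ.prod P E = ρ A := by
    rw [Measure.prod_apply hE, ← lintegral_indicator_one hAm]
    refine lintegral_congr_ae ?_
    filter_upwards [h01] with x hx
    change f x = _
    rcases hx with hx | hx <;> simp [hA, hx]
  rw [hmeas]
  refine h.zero_or_one A hAm fun t => ?_
  filter_upwards [Measure.ae_ae_of_ae_prod (h.invariant_of_rat hAm hinv t)] with x hx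
  by_cases hxA : x ∈ A
  · rw [indicator_of_mem hxA]
    refine (mem_ae_iff_prob_eq_one (D.measurable_φ_apply t x hAm)).1 ?_
    exact hx.mono fun ω hω => hω.2 hxA
  · rw [indicator_of_notMem hxA, measure_eq_zero_iff_ae_notMem]
    exact hx.mono fun ω hω => mt hω.1 hxA

lemma Ergodic.ae_mem_of_skew (h : D.Ergodic ρ) {E : Set (X × Ω)} (hE : MeasurableSet E)
    (hsub : ∀ q ∈ rat T, ∀ p, D.skew q p ∈ E → p ∈ E) (hpos : ρ.prod P E ≠ 0) :
    ∀ᵐ p ∂ρ.prod P, p ∈ E :=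
  (mem_ae_iff_prob_eq_one hE).2 ((h.skew_zero_or_one hE hsub).resolve_left hpos)

end Skew

end ForwardSystem

/-! ### Contraction and synchronisation along a family of maps -/

section Flow

variable {T : AddSubgroup ℝ} {X : Type*} [MetricSpace X] {ψ : NonnegTime T → X → X} {A B : Set X}
  {x y z : X}

/-- The set `A` contracts under the maps `ψ t` as `t → ∞`. -/
def FlowContracts (ψ : NonnegTime T → X → X) (A : Set X) : Prop :=
  Tendsto (fun t => Metric.ediam (ψ t '' A)) atTop (𝓝 0)

/-- The trajectories of `x` and `y` under the maps `ψ t` synchronise as `t → ∞`. -/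
def FlowSync (ψ : NonnegTime T → X → X) (x y : X) : Prop :=
  Tendsto (fun t => edist (ψ t x) (ψ t y)) atTop (𝓝 0)

lemma FlowSync.tendsto_dist (h : FlowSync ψ x y) :
    Tendsto (fun t => dist (ψ t x) (ψ t y)) atTop (𝓝 0) := by
  simpa [dist_edist, Function.comp_def] using (ENNReal.tendsto_toReal ENNReal.zero_ne_top).comp h

lemma FlowSync.symm (h : FlowSync ψ x y) : FlowSync ψ y x := by
  simpa only [FlowSync, edist_comm] using h

lemma FlowSync.trans (h : FlowSync ψ x y) (h' : FlowSync ψ y z) : FlowSync ψ x z := by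
  refine tendsto_of_tendsto_of_tendsto_of_le_of_le tendsto_const_nhds ?_ (fun _ => bot_le)
    (fun t => edist_triangle _ (ψ t y) _)
  simpa using Tendsto.add h h'

lemma FlowContracts.mono (h : FlowContracts ψ A) (hBA : B ⊆ A) : FlowContracts ψ B :=
  tendsto_of_tendsto_of_tendsto_of_le_of_le tendsto_const_nhds h (fun _ => bot_le)
    fun _ => Metric.ediam_mono (image_mono hBA)

lemma FlowContracts.sync (h : FlowContracts ψ A) (hx : x ∈ A) (hy : y ∈ A) : FlowSync ψ x y :=
  tendsto_of_tendsto_of_tendsto_of_le_of_le tendsto_const_nhds h (fun _ => bot_le)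
    fun _ => Metric.edist_le_ediam_of_mem (mem_image_of_mem _ hx) (mem_image_of_mem _ hy)

lemma FlowContracts.union (hA : FlowContracts ψ A) (hB : FlowContracts ψ B)
    (hsync : ∀ x ∈ A, ∀ y ∈ B, FlowSync ψ x y) : FlowContracts ψ (A ∪ B) := by
  rcases A.eq_empty_or_nonempty with rfl | ⟨x, hx⟩
  · simpa using hB
  rcases B.eq_empty_or_nonempty with rfl | ⟨y, hy⟩
  · simpa using hA
  refine tendsto_of_tendsto_of_tendsto_of_le_of_le tendsto_const_nhds ?_ (fun _ => bot_le)
    (fun t => (image_union (ψ t) A B ▸ Metric.ediam_union_le_add_edist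
      (mem_image_of_mem _ hx) (mem_image_of_mem _ hy)))
  simpa using (Tendsto.add hA (hsync x hx y hy)).add hB

lemma FlowContracts.biUnion {ι : Type*} {s : Set ι} (hs : s.Finite) {f : ι → Set X}
    (hf : ∀ i ∈ s, FlowContracts ψ (f i))
    (hsync : ∀ i ∈ s, ∀ j ∈ s, ∀ x ∈ f i, ∀ y ∈ f j, FlowSync ψ x y) :
    FlowContracts ψ (⋃ i ∈ s, f i) := by
  induction s, hs using Set.Finite.induction_on with
  | empty => simp [FlowContracts]
  | @insert a s _ _ ih =>
    rw [biUnion_insert]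
    refine (hf a (mem_insert _ _)).union
      (ih (fun i hi => hf i (mem_insert_of_mem _ hi))
        fun i hi j hj => hsync i (mem_insert_of_mem _ hi) j (mem_insert_of_mem _ hj)) ?_
    intro x hx y hy
    obtain ⟨i, hi, hyi⟩ := mem_iUnion₂.1 hy
    exact hsync a (mem_insert _ _) i (mem_insert_of_mem _ hi) x hx y hyi

lemma FlowContracts.closure (h : FlowContracts ψ A) (hψ : ∀ t, Continuous (ψ t)) :
    FlowContracts ψ (closure A) :=
  tendsto_of_tendsto_of_tendsto_of_le_of_le tendsto_const_nhds h (fun _ => bot_le)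
    fun t => (Metric.ediam_mono (image_closure_subset_closure_image (hψ t))).trans
      (Metric.ediam_closure _).le

end Flow

namespace ForwardSystem

open NonnegTime TopologicalSpace

variable {T : AddSubgroup ℝ} {Ω : Type*} [mΩ : MeasurableSpace Ω] {P : Measure Ω}
  {X : Type*} [MetricSpace X] [SecondCountableTopology X] [MeasurableSpace X] [BorelSpace X]
  (D : ForwardSystem T Ω P X)

/-- The maps `φ(t,ω)`, `t ≥ 0`, for a fixed realisation `ω` of the noise. -/
abbrev flow (ω : Ω) : NonnegTime T → X → X := fun t => D.φ t ω

lemma flowContracts_shift (s : NonnegTime T) (ω : Ω) (A : Set X) :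
    FlowContracts (D.flow (D.θ s ω)) (D.φ s ω '' A) ↔ FlowContracts (D.flow ω) A := by
  unfold FlowContracts
  rw [← NonnegTime.tendsto_add_atTop_iff (fun t => Metric.ediam (D.flow ω t '' A)) s]
  simp only [flow, image_image, D.cocycle]

lemma flowSync_shift (s : NonnegTime T) (ω : Ω) (x y : X) :
    FlowSync (D.flow (D.θ s ω)) (D.φ s ω x) (D.φ s ω y) ↔ FlowSync (D.flow ω) x y := by
  unfold FlowSync
  rw [← NonnegTime.tendsto_add_atTop_iff (fun t => edist (D.flow ω t x) (D.flow ω t y)) s]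
  simp only [flow, D.cocycle]

lemma tendsto_flow {ω : Ω} {u : ℕ → NonnegTime T} {t : NonnegTime T} (hu : Antitone u)
    (hut : Tendsto u atTop (𝓝 t)) (x : X) :
    Tendsto (fun n => D.φ (u n) ω x) atTop (𝓝 (D.φ t ω x)) :=
  D.right_continuous ω u t (fun _ => x) x hu hut tendsto_const_nhds

lemma exists_rat_of_isOpen {ω : Ω} {x y : X} {V : Set (X × X)} (hV : IsOpen V) {t : NonnegTime T}
    (ht : (D.φ t ω x, D.φ t ω y) ∈ V) : ∃ q ∈ rat T, (D.φ q ω x, D.φ q ω y) ∈ V := by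
  obtain ⟨u, hanti, hrat, hlim⟩ := D.rightDense t
  obtain ⟨n, hn⟩ := (((D.tendsto_flow hanti hlim x).prodMk_nhds
    (D.tendsto_flow hanti hlim y)).eventually (hV.mem_nhds ht)).exists
  exact ⟨u n, hrat n, hn⟩

/-- The convergence of diameters to `0` can be tested on rational times: a bound on the rational
times after `m` extends to all times after `m` by right-continuity. -/
lemma flowContracts_iff_rat (ω : Ω) (A : Set X) : FlowContracts (D.flow ω) A ↔
    ∀ n : ℕ, ∃ m : ℕ, ∀ q ∈ rat T, ofNat D.one_mem m ≤ q →
      Metric.ediam (D.φ q ω '' A) ≤ ((n : ENNReal) + 1)⁻¹ := by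
  constructor
  · intro h n
    have hpos : (0 : ENNReal) < ((n : ENNReal) + 1)⁻¹ := by simp
    obtain ⟨t, ht⟩ := eventually_atTop.1 (h.eventually_le_const hpos)
    obtain ⟨m, hm⟩ := exists_le_ofNat D.one_mem t
    exact ⟨m, fun q _ hq => ht q (hm.trans hq)⟩
  · intro h
    refine ENNReal.tendsto_nhds_zero.2 fun ε hε => ?_
    obtain ⟨n, hn⟩ := ENNReal.exists_inv_nat_lt hε.ne'
    obtain ⟨m, hm⟩ := h n
    refine eventually_atTop.2 ⟨ofNat D.one_mem m, fun t ht => ?_⟩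
    refine Metric.ediam_le ?_
    rintro - ⟨x, hx, rfl⟩ - ⟨y, hy, rfl⟩
    obtain ⟨u, hanti, hrat, hlim⟩ := D.rightDense t
    refine le_trans (le_of_tendsto ((D.tendsto_flow hanti hlim x).edist
      (D.tendsto_flow hanti hlim y)) (Eventually.of_forall fun k => ?_)) hn.le
    refine ((Metric.edist_le_ediam_of_mem (mem_image_of_mem _ hx) (mem_image_of_mem _ hy)).trans
      (hm (u k) (hrat k) (ht.trans (hanti.le_of_tendsto hlim k)))).trans ?_
    exact ENNReal.inv_le_inv.2 le_self_add

lemma flowSync_iff_contracts (ω : Ω) (x y : X) :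
    FlowSync (D.flow ω) x y ↔ FlowContracts (D.flow ω) {x, y} := by
  simp [FlowSync, FlowContracts, image_pair, Metric.ediam_pair]

lemma measurableSet_sync : MeasurableSet {p : (X × X) × Ω | FlowSync (D.flow p.2) p.1.1 p.1.2} := by
  simp only [flowSync_iff_contracts, flowContracts_iff_rat, image_pair, Metric.ediam_pair,
    ofPred_forall, ofPred_exists]
  refine MeasurableSet.iInter fun n => MeasurableSet.iUnion fun m =>
    MeasurableSet.biInter countable_rat fun q _ => MeasurableSet.iInter fun _ => ?_
  refine measurableSet_le (Measurable.edist ?_ ?_) measurable_const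
  · exact (D.measurable_φ q).comp (by fun_prop : Measurable fun p : (X × X) × Ω => (p.1.1, p.2))
  · exact (D.measurable_φ q).comp (by fun_prop : Measurable fun p : (X × X) × Ω => (p.1.2, p.2))

lemma flowContracts_inter_dense {C : Set X} (hC : Dense C) {U : Set X} (hU : IsOpen U) (ω : Ω) :
    FlowContracts (D.flow ω) (U ∩ C) ↔ FlowContracts (D.flow ω) U :=
  ⟨fun h => (h.closure fun t => D.continuous_space t ω).mono (hC.open_subset_closure_inter hU),
    fun h => h.mono inter_subset_left⟩

lemma measurableSet_contracts {U : Set X} (hU : IsOpen U) :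
    MeasurableSet {ω | FlowContracts (D.flow ω) U} := by
  obtain ⟨C, hCc, hC⟩ := exists_countable_dense X
  simp only [← D.flowContracts_inter_dense hC hU, flowContracts_iff_rat, Metric.ediam,
    iSup_image, ofPred_forall, ofPred_exists]
  refine MeasurableSet.iInter fun n => MeasurableSet.iUnion fun m =>
    MeasurableSet.biInter countable_rat fun q _ => MeasurableSet.iInter fun _ => ?_
  have hcount : (U ∩ C).Countable := hCc.mono inter_subset_right
  refine measurableSet_le (Measurable.biSup _ hcount fun x _ => Measurable.biSup _ hcount
    fun y _ => ?_) measurable_const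
  exact (D.measurable_φ_apply q x).edist (D.measurable_φ_apply q y)

end ForwardSystem

namespace ForwardSystem

open NonnegTime TopologicalSpace

variable {T : AddSubgroup ℝ} {Ω : Type*} [mΩ : MeasurableSpace Ω] {P : Measure Ω}
  [IsProbabilityMeasure P]
  {X : Type*} [MetricSpace X] [SecondCountableTopology X] [MeasurableSpace X] [BorelSpace X]
  {D : ForwardSystem T Ω P X} {ρ : Measure X} [IsProbabilityMeasure ρ]

/-! ### Recurrence and local contraction -/

/-- Almost every trajectory visits a given set of positive measure. -/
lemma Ergodic.ae_exists_mem (h : D.Ergodic ρ) {A : Set X} (hA : MeasurableSet A)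
    (hpos : ρ A ≠ 0) : ∀ᵐ p ∂ρ.prod P, ∃ q ∈ rat T, D.φ q p.2 p.1 ∈ A := by
  have hE : MeasurableSet {p : X × Ω | ∃ q ∈ rat T, D.φ q p.2 p.1 ∈ A} := by
    have : {p : X × Ω | ∃ q ∈ rat T, D.φ q p.2 p.1 ∈ A}
        = ⋃ q ∈ rat T, (fun p : X × Ω => D.φ q p.2 p.1) ⁻¹' A := by
      ext p; simp
    rw [this]
    exact MeasurableSet.biUnion countable_rat fun q _ => D.measurable_φ q hA
  refine h.ae_mem_of_skew hE (fun q hq p hp => ?_) fun h0 => hpos ?_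
  · obtain ⟨q', hq', hmem⟩ := hp
    refine ⟨q + q', add_mem_rat hq hq', ?_⟩
    rw [D.cocycle]
    exact hmem
  · have hsub : A ×ˢ (univ : Set Ω) ⊆ {p : X × Ω | ∃ q ∈ rat T, D.φ q p.2 p.1 ∈ A} :=
      fun p hp => ⟨0, zero_mem_rat, by rw [D.map_zero]; exact hp.1⟩
    have := measure_mono_null hsub h0
    rwa [Measure.prod_prod, measure_univ, mul_one] at this

/-- Almost every trajectory visits every open set of positive measure at arbitrarily late times. -/
lemma Ergodic.ae_recurrent (h : D.Ergodic ρ) :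
    ∀ᵐ p ∂ρ.prod P, ∀ U : Set X, IsOpen U → 0 < ρ U → ∀ s : ℕ,
      ∃ t, ofNat D.one_mem s ≤ t ∧ D.φ t p.2 p.1 ∈ U := by
  have hbasis : ∀ᵐ p ∂ρ.prod P, ∀ B ∈ countableBasis X, ρ B ≠ 0 → ∀ s : ℕ,
      ∃ t, ofNat D.one_mem s ≤ t ∧ D.φ t p.2 p.1 ∈ B := by
    refine (ae_ball_iff (countable_countableBasis X)).2 fun B hB => ?_
    by_cases hpos : ρ B = 0
    · exact ae_of_all _ fun _ h => absurd hpos h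
    refine (ae_all_iff.2 fun s => ?_).mono fun p hp _ => hp
    have hs := h.ae_exists_mem (isOpen_of_mem_countableBasis hB).measurableSet hpos
    filter_upwards [(h.measurePreserving_skew (ofNat D.one_mem s)).quasiMeasurePreserving.ae hs]
      with p ⟨q, _, hq⟩
    exact ⟨_, le_add_time _ q, by rw [D.cocycle]; exact hq⟩
  filter_upwards [hbasis] with p hp U hU hpos s
  have hex : ∃ B ∈ countableBasis X, B ⊆ U ∧ ρ B ≠ 0 := by
    by_contra! hcon
    rw [(isBasis_countableBasis X).open_eq_sUnion' hU] at hpos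
    refine hpos.ne' ((measure_sUnion_null_iff ?_).2 fun B hB => hcon B hB.1 hB.2)
    exact (countable_countableBasis X).mono fun B hB => hB.1
  obtain ⟨B, hB, hBU, hB0⟩ := hex
  obtain ⟨t, hst, ht⟩ := hp B hB hB0 s
  exact ⟨t, hst, hBU ht⟩

/-- Stability yields a basic open set of positive measure that contracts with positive
probability. -/
lemma exists_contracting_basis
    (hst : 0 < P {ω | ∃ U : Set X, IsOpen U ∧ (U ∩ ρ.support).Nonempty ∧
      FlowContracts (D.flow ω) U}) :
    ∃ B ∈ countableBasis X, ρ B ≠ 0 ∧ P {ω | FlowContracts (D.flow ω) B} ≠ 0 := by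
  by_contra! hcon
  have hnull : P (⋃ B ∈ {B ∈ countableBasis X | ρ B ≠ 0}, {ω | FlowContracts (D.flow ω) B}) = 0 :=
    (measure_biUnion_null_iff ((countable_countableBasis X).mono fun B hB => hB.1)).2
      fun B hB => hcon B hB.1 hB.2
  refine hst.ne' (measure_mono_null ?_ hnull)
  rintro ω ⟨U, hU, ⟨x, hxU, hx⟩, hc⟩
  obtain ⟨B, hB, hxB, hBU⟩ := (isBasis_countableBasis X).exists_subset_of_mem_open hxU hU
  refine mem_biUnion (x := B) ⟨hB, ?_⟩ (hc.mono hBU)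
  exact ((Measure.mem_support_iff_forall x).1 hx B
    ((isOpen_of_mem_countableBasis hB).mem_nhds hxB)).ne'

/-- Under stability, almost every point has a contracting neighbourhood. -/
lemma Ergodic.ae_exists_contracting_nhd (h : D.Ergodic ρ) {B : Set X} (hB : B ∈ countableBasis X)
    (hρ : ρ B ≠ 0) (hP : P {ω | FlowContracts (D.flow ω) B} ≠ 0) :
    ∀ᵐ p ∂ρ.prod P, ∃ B ∈ countableBasis X, p.1 ∈ B ∧ FlowContracts (D.flow p.2) B := by
  have hE : MeasurableSet
      {p : X × Ω | ∃ B ∈ countableBasis X, p.1 ∈ B ∧ FlowContracts (D.flow p.2) B} := by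
    have : {p : X × Ω | ∃ B ∈ countableBasis X, p.1 ∈ B ∧ FlowContracts (D.flow p.2) B}
        = ⋃ B ∈ countableBasis X, B ×ˢ {ω | FlowContracts (D.flow ω) B} := by
      ext p; simp [and_left_comm]
    rw [this]
    exact MeasurableSet.biUnion (countable_countableBasis X) fun B hB =>
      (isOpen_of_mem_countableBasis hB).measurableSet.prod
        (D.measurableSet_contracts (isOpen_of_mem_countableBasis hB))
  refine h.ae_mem_of_skew hE (fun q _ p hp => ?_) fun h0 => ?_
  · obtain ⟨B, hB, hmem, hc⟩ := hp
    have hopen : IsOpen (D.φ q p.2 ⁻¹' B) :=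
      (isOpen_of_mem_countableBasis hB).preimage (D.continuous_space q p.2)
    obtain ⟨B', hB', hpB', hsub⟩ :=
      (isBasis_countableBasis X).exists_subset_of_mem_open (show p.1 ∈ D.φ q p.2 ⁻¹' B from hmem)
        hopen
    exact ⟨B', hB', hpB', (D.flowContracts_shift q p.2 B').1 (hc.mono (image_subset_iff.2 hsub))⟩
  · have hsub : B ×ˢ {ω | FlowContracts (D.flow ω) B} ⊆
        {p : X × Ω | ∃ B ∈ countableBasis X, p.1 ∈ B ∧ FlowContracts (D.flow p.2) B} :=
      fun p hp => ⟨B, hB, hp.1, hp.2⟩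
    have := measure_mono_null hsub h0
    rw [Measure.prod_prod] at this
    exact (mul_ne_zero hρ hP) this

/-- If `B` contracts with positive probability and the trajectories of `x` and `y` are in `B` at
time `q` with positive probability, then two neighbourhoods of `x` and `y` together contract with
positive probability: they are mapped into `B` with positive probability, and what happens in `B`
afterwards is independent of that. -/
lemma exists_contracting_nhds {B : Set X} (hB : IsOpen B)
    (hP : P {ω | FlowContracts (D.flow ω) B} ≠ 0) {q : NonnegTime T} {x y : X}
    (hxy : P {ω | D.φ q ω x ∈ B ∧ D.φ q ω y ∈ B} ≠ 0) :
    ∃ W ∈ countableBasis X, ∃ W' ∈ countableBasis X, x ∈ W ∧ y ∈ W' ∧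
      P {ω | FlowContracts (D.flow ω) (W ∪ W')} ≠ 0 := by
  have hex : ∃ p ∈ countableBasis X ×ˢ countableBasis X, x ∈ p.1 ∧ y ∈ p.2 ∧
      P {ω | D.φ q ω '' (p.1 ∪ p.2) ⊆ B} ≠ 0 := by
    by_contra! hcon
    have hnull : P (⋃ p ∈ {p ∈ countableBasis X ×ˢ countableBasis X | x ∈ p.1 ∧ y ∈ p.2},
        {ω | D.φ q ω '' (p.1 ∪ p.2) ⊆ B}) = 0 :=
      (measure_biUnion_null_iff (((countable_countableBasis X).prod
        (countable_countableBasis X)).mono fun p hp => hp.1)).2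
        fun p hp => hcon p hp.1 hp.2.1 hp.2.2
    refine hxy (measure_mono_null ?_ hnull)
    rintro ω ⟨hx, hy⟩
    change x ∈ D.φ q ω ⁻¹' B at hx
    change y ∈ D.φ q ω ⁻¹' B at hy
    have hopen := hB.preimage (D.continuous_space q ω)
    obtain ⟨W, hW, hxW, hWB⟩ := (isBasis_countableBasis X).exists_subset_of_mem_open hx hopen
    obtain ⟨W', hW', hyW', hWB'⟩ := (isBasis_countableBasis X).exists_subset_of_mem_open hy hopen
    exact mem_biUnion (x := (W, W')) ⟨⟨hW, hW'⟩, hxW, hyW'⟩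
      (image_subset_iff.2 (union_subset hWB hWB'))
  obtain ⟨⟨W, W'⟩, ⟨hW, hW'⟩, hx, hy, hpos⟩ := hex
  refine ⟨W, hW, W', hW', hx, hy, ?_⟩
  have hWo : IsOpen (W ∪ W') :=
    (isOpen_of_mem_countableBasis hW).union (isOpen_of_mem_countableBasis hW')
  obtain ⟨C, hCc, hC⟩ := exists_countable_dense X
  -- only countably many points are followed up to time `q`, so as to have a measurable event
  have hGm : MeasurableSet[D.F q] {ω | ∀ z ∈ (W ∪ W') ∩ C, D.φ q ω z ∈ B} := by
    simp only [ofPred_forall]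
    exact MeasurableSet.biInter (hCc.mono inter_subset_right)
      fun z _ => D.adapted q z hB.measurableSet
  have hGpos : P {ω | ∀ z ∈ (W ∪ W') ∩ C, D.φ q ω z ∈ B} ≠ 0 := fun h0 =>
    by
    refine hpos (measure_mono_null ?_ h0)
    intro ω hω z hz
    exact hω (mem_image_of_mem _ hz.1)
  have hcm := D.measurableSet_contracts hB
  have hind := (Indep_iff _ _ _).1 (D.indep q) _ _ hGm ⟨_, hcm, rfl⟩
  rw [(D.measurePreserving q).measure_preimage hcm.nullMeasurableSet] at hind
  refine fun h0 => mul_ne_zero hGpos hP (hind ▸ measure_mono_null ?_ h0)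
  rintro ω ⟨hω, hω'⟩
  refine (D.flowContracts_inter_dense hC hWo ω).1 ((D.flowContracts_shift q ω _).1 ?_)
  exact FlowContracts.mono hω' (image_subset_iff.2 hω)

/-- If the pair `(x, y)` is contractible towards the transitive points, then pairs near `(x, y)`
synchronise with probability bounded away from `0`. -/
lemma eventually_le_prob_sync {B₀ : Set X} (hB₀ : B₀ ∈ countableBasis X)
    (hρ : ρ B₀ ≠ 0) (hP : P {ω | FlowContracts (D.flow ω) B₀} ≠ 0) {A : Set X}
    (hA : ∀ p ∈ A, ∀ U, IsOpen U → 0 < ρ U → 0 < P {ω | ∃ t, D.φ t ω p ∈ U}) {x y : X}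
    (hxy : ∀ V ∈ 𝓝ˢ ((fun a : X => (a, a)) '' A), 0 < P {ω | ∃ t, (D.φ t ω x, D.φ t ω y) ∈ V}) :
    ∃ δ : ℝ, 0 < δ ∧ ∀ᶠ z in 𝓝 (x, y), δ ≤ P.real {ω | FlowSync (D.flow ω) z.1 z.2} := by
  -- a visit of positive probability to an open set of pairs occurs at some rational time
  have hrat : ∀ {x y : X} {V : Set (X × X)}, IsOpen V →
      0 < P {ω | ∃ t, (D.φ t ω x, D.φ t ω y) ∈ V} →
      ∃ q, P {ω | (D.φ q ω x, D.φ q ω y) ∈ V} ≠ 0 := by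
    intro x y V hV hpos
    by_contra! hcon
    refine hpos.ne' (measure_mono_null ?_ ((measure_biUnion_null_iff countable_rat).2
      fun q _ => hcon q))
    rintro ω ⟨t, ht⟩
    obtain ⟨q, hq, hqV⟩ := D.exists_rat_of_isOpen hV ht
    exact mem_biUnion hq hqV
  let 𝓑 := {B ∈ countableBasis X | P {ω | FlowContracts (D.flow ω) B} ≠ 0}
  have h𝓑 : ∀ p ∈ A, ∃ B ∈ 𝓑, p ∈ B := by
    intro p hp
    have hB₀o := isOpen_of_mem_countableBasis hB₀
    obtain ⟨q, hq⟩ := hrat (x := p) (y := p) (hB₀o.prod hB₀o)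
      (by simpa using hA p hp B₀ hB₀o (pos_iff_ne_zero.2 hρ))
    obtain ⟨W, hW, W', -, hpW, -, hW0⟩ := exists_contracting_nhds hB₀o hP (x := p) (y := p) hq
    refine ⟨W, ⟨hW, fun h0 => hW0 (measure_mono_null (fun ω hω => ?_) h0)⟩, hpW⟩
    exact FlowContracts.mono hω subset_union_left
  have hVo : ∀ B ∈ 𝓑, IsOpen (B ×ˢ B) := fun B hB =>
    (isOpen_of_mem_countableBasis hB.1).prod (isOpen_of_mem_countableBasis hB.1)
  have hV : IsOpen (⋃ B ∈ 𝓑, B ×ˢ B) := isOpen_biUnion hVo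
  have hVA : (⋃ B ∈ 𝓑, B ×ˢ B) ∈ 𝓝ˢ ((fun a : X => (a, a)) '' A) := by
    refine hV.mem_nhdsSet.2 ?_
    rintro - ⟨p, hp, rfl⟩
    obtain ⟨B, hB, hpB⟩ := h𝓑 p hp
    exact mem_biUnion hB ⟨hpB, hpB⟩
  obtain ⟨q, hq⟩ := hrat hV (hxy _ hVA)
  have hex : ∃ B ∈ 𝓑, P {ω | D.φ q ω x ∈ B ∧ D.φ q ω y ∈ B} ≠ 0 := by
    by_contra! hcon
    refine hq (measure_mono_null ?_ ((measure_biUnion_null_iff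
      ((countable_countableBasis X).mono fun B (hB : B ∈ 𝓑) => hB.1)).2 hcon))
    intro ω hω
    obtain ⟨B, hB, hmem⟩ := mem_iUnion₂.1 (show _ ∈ ⋃ B ∈ 𝓑, B ×ˢ B from hω)
    exact mem_biUnion hB hmem
  obtain ⟨B, hB, hBpos⟩ := hex
  obtain ⟨W, hW, W', hW', hxW, hyW', hpos⟩ :=
    exists_contracting_nhds (isOpen_of_mem_countableBasis hB.1) hB.2 hBpos
  refine ⟨P.real {ω | FlowContracts (D.flow ω) (W ∪ W')},
    ENNReal.toReal_pos hpos (measure_ne_top _ _), ?_⟩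
  filter_upwards [((isOpen_of_mem_countableBasis hW).prod
    (isOpen_of_mem_countableBasis hW')).mem_nhds ⟨hxW, hyW'⟩] with z hz
  exact measureReal_mono fun ω hω => FlowContracts.sync hω (Or.inl hz.1) (Or.inr hz.2)

end ForwardSystem

namespace ForwardSystem

open NonnegTime TopologicalSpace

variable {T : AddSubgroup ℝ} {Ω : Type*} [mΩ : MeasurableSpace Ω] {P : Measure Ω}
  [IsProbabilityMeasure P]
  {X : Type*} [MetricSpace X] [SecondCountableTopology X] [MeasurableSpace X] [BorelSpace X]
  {D : ForwardSystem T Ω P X} {ρ : Measure X} [IsProbabilityMeasure ρ]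

/-! ### Synchronisation of almost all pairs -/

lemma measurePreserving_pair_fst :
    MeasurePreserving (fun p : (X × X) × Ω => (p.1.1, p.2)) ((ρ.prod ρ).prod P) (ρ.prod P) :=
  measurePreserving_fst.prod (MeasurePreserving.id P)

lemma measurePreserving_pair_snd :
    MeasurePreserving (fun p : (X × X) × Ω => (p.1.2, p.2)) ((ρ.prod ρ).prod P) (ρ.prod P) :=
  measurePreserving_snd.prod (MeasurePreserving.id P)

/-- At late times it is unlikely that `x` is in a compact set `K` while `x` and `y` do not
synchronise, if pairs in `K × A₂` synchronise with a probability that is locally bounded away from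
`0` and `A₂` has full measure. Indeed `y` is then in a large compact subset of `A₂`, so that the
conditional probability of synchronisation is bounded below, while by Lévy's law it tends to `0` in
the absence of synchronisation. -/
lemma Ergodic.tendsto_mem_not_sync (h : D.Ergodic ρ) {K A₂ : Set X} (hK : IsCompact K)
    (hA₂ : ∀ r < (1 : ENNReal), ∃ K₂ ⊆ A₂, IsCompact K₂ ∧ r < ρ K₂)
    (hδ : ∀ x ∈ K, ∀ y ∈ A₂, ∃ δ : ℝ, 0 < δ ∧
      ∀ᶠ z in 𝓝 (x, y), δ ≤ P.real {ω | FlowSync (D.flow ω) z.1 z.2})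
    {u : ℕ → NonnegTime T} (hu : Monotone u) (hu' : Tendsto u atTop atTop) :
    Tendsto (fun n => (ρ.prod ρ).prod P
      {p | D.φ (u n) p.2 p.1.1 ∈ K ∧ ¬ FlowSync (D.flow p.2) p.1.1 p.1.2}) atTop (𝓝 0) := by
  have hS := D.measurableSet_sync
  set S : Set ((X × X) × Ω) := {p | FlowSync (D.flow p.2) p.1.1 p.1.2} with hSdef
  set s : X × X → ℝ := fun z => P.real {ω | (z, ω) ∈ S} with hs
  have hsm : Measurable s := (measurable_measure_prodMk_left hS).ennreal_toReal
  refine ENNReal.tendsto_nhds_zero.2 fun ε hε => ?_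
  have hε2 : ε / 2 ≠ 0 := by simpa using hε.ne'
  obtain ⟨K₂, hK₂A, hK₂, hρK₂⟩ := hA₂ (1 - ε / 2)
    (ENNReal.sub_lt_self ENNReal.one_ne_top one_ne_zero hε2)
  have hK₂c : ρ K₂ᶜ ≤ ε / 2 := by
    rw [prob_compl_eq_one_sub hK₂.measurableSet]
    exact tsub_le_iff_tsub_le.1 hρK₂.le
  obtain ⟨δ, hδ0, hδK⟩ : ∃ δ : ℝ, 0 < δ ∧ ∀ z ∈ K ×ˢ K₂, δ ≤ s z := by
    refine (hK.prod hK₂).induction_on (p := fun C => ∃ δ : ℝ, 0 < δ ∧ ∀ z ∈ C, δ ≤ s z)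
      ⟨1, one_pos, by simp⟩ ?_ ?_ ?_
    · rintro C C' hCC' ⟨δ, h0, hC⟩
      exact ⟨δ, h0, fun z hz => hC z (hCC' hz)⟩
    · rintro C C' ⟨δ, h0, hC⟩ ⟨δ', h0', hC'⟩
      refine ⟨min δ δ', lt_min h0 h0', ?_⟩
      rintro z (hz | hz)
      · exact (min_le_left _ _).trans (hC z hz)
      · exact (min_le_right _ _).trans (hC' z hz)
    · rintro ⟨x, y⟩ ⟨hx, hy⟩
      obtain ⟨δ, h0, hev⟩ := hδ x hx y (hK₂A hy)
      exact ⟨_, mem_nhdsWithin_of_mem_nhds hev, δ, h0, fun z hz => hz⟩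
  have hpair : ∀ n, Measurable fun p : (X × X) × Ω =>
      (D.φ (u n) p.2 p.1.1, D.φ (u n) p.2 p.1.2) := fun n =>
    ((D.measurable_φ (u n)).comp (by fun_prop : Measurable fun p : (X × X) × Ω =>
      (p.1.1, p.2))).prodMk ((D.measurable_φ (u n)).comp (by fun_prop : Measurable
      fun p : (X × X) × Ω => (p.1.2, p.2)))
  have hEm : ∀ n, MeasurableSet
      {p : (X × X) × Ω | δ ≤ s (D.φ (u n) p.2 p.1.1, D.φ (u n) p.2 p.1.2) ∧ p ∉ S} := fun n =>
    (measurableSet_le measurable_const (hsm.comp (hpair n))).inter hS.compl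
  have hlim : Tendsto (fun n => ∫⁻ z, P {ω | δ ≤ s (D.φ (u n) ω z.1, D.φ (u n) ω z.2) ∧
      (z, ω) ∉ S} ∂ρ.prod ρ) atTop (𝓝 (∫⁻ _, 0 ∂ρ.prod ρ)) := by
    refine tendsto_lintegral_of_dominated_convergence (fun _ => 1)
      (fun n => measurable_measure_prodMk_left (hEm n))
      (fun n => ae_of_all _ fun x => prob_le_one) (by simp) (ae_of_all _ fun z => ?_)
    have hsec : MeasurableSet {ω | (z, ω) ∈ S} := measurable_prodMk_left hS
    have hL := D.tendstoInMeasure_condProb hS hu hu'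
      (z := fun n ω => (D.φ (u n) ω z.1, D.φ (u n) ω z.2))
      (fun n => Measurable.prodMk (D.adapted (u n) z.1) (D.adapted (u n) z.2))
      hsec (fun n => ae_of_all _ fun ω => (D.flowSync_shift (u n) ω z.1 z.2).symm)
    refine tendsto_of_tendsto_of_tendsto_of_le_of_le tendsto_const_nhds
      (hL (ENNReal.ofReal δ) (by simpa using hδ0)) (fun _ => bot_le)
      fun n => measure_mono fun ω hω => ?_
    change ENNReal.ofReal δ ≤ edist (s (D.φ (u n) ω z.1, D.φ (u n) ω z.2)) _
    rw [edist_dist, Real.dist_eq, indicator_of_notMem (by exact hω.2), sub_zero]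
    exact ENNReal.ofReal_le_ofReal (hω.1.trans (le_abs_self _))
  rw [lintegral_zero] at hlim
  filter_upwards [ENNReal.tendsto_nhds_zero.1 hlim (ε / 2) (pos_iff_ne_zero.2 hε2)] with n hn
  have hle : (ρ.prod ρ).prod P {p | D.φ (u n) p.2 p.1.2 ∈ K₂ᶜ} ≤ ε / 2 := by
    have hmp := (h.measurePreserving_φ (u n)).comp (measurePreserving_pair_snd (P := P) (ρ := ρ))
    exact (hmp.measure_preimage hK₂.measurableSet.compl.nullMeasurableSet).trans_le hK₂c
  refine (measure_mono (t := {p | D.φ (u n) p.2 p.1.2 ∈ K₂ᶜ} ∪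
    {p | δ ≤ s (D.φ (u n) p.2 p.1.1, D.φ (u n) p.2 p.1.2) ∧ p ∉ S}) ?_).trans
    ((measure_union_le _ _).trans ?_)
  · rintro p ⟨hpK, hp⟩
    by_cases hy : D.φ (u n) p.2 p.1.2 ∈ K₂
    · exact Or.inr ⟨hδK _ ⟨hpK, hy⟩, hp⟩
    · exact Or.inl hy
  · rw [Measure.prod_apply (hEm n)]
    exact (add_le_add hle hn).trans (ENNReal.add_halves ε).le

/-- Almost all pairs synchronise almost surely, if there is a full-length rectangle `A₁ × A₂` of
pairs around which the probability of synchronisation is locally bounded away from `0`. Outside a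
set of small measure, trajectories visit a compact `K ⊆ A₁` at one of finitely many times `q`; by
stationarity the same holds for the times `n + q`, for every `n`, and as `n → ∞` visits to `K`
without synchronisation become improbable. -/
lemma Ergodic.ae_sync (h : D.Ergodic ρ) {A₁ A₂ : Set X}
    (hA₁ : ∃ K ⊆ A₁, IsCompact K ∧ 0 < ρ K)
    (hA₂ : ∀ r < (1 : ENNReal), ∃ K₂ ⊆ A₂, IsCompact K₂ ∧ r < ρ K₂)
    (hδ : ∀ x ∈ A₁, ∀ y ∈ A₂, ∃ δ : ℝ, 0 < δ ∧
      ∀ᶠ z in 𝓝 (x, y), δ ≤ P.real {ω | FlowSync (D.flow ω) z.1 z.2}) :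
    ∀ᵐ p ∂(ρ.prod ρ).prod P, FlowSync (D.flow p.2) p.1.1 p.1.2 := by
  obtain ⟨K, hKA, hK, hKpos⟩ := hA₁
  obtain ⟨q, hq⟩ := (countable_rat (T := T)).exists_eq_range ⟨0, zero_mem_rat⟩
  -- the pairs `(x, ω)` that do not visit `K` at the first `N` rational times
  let G : ℕ → Set (X × Ω) := fun N => {p | ∀ i < N, D.φ (q i) p.2 p.1 ∉ K}
  have hGm : ∀ N, MeasurableSet (G N) := fun N => by
    simp only [G, ofPred_forall]
    exact MeasurableSet.iInter fun i => MeasurableSet.iInter fun _ =>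
      (D.measurable_φ (q i) hK.measurableSet).compl
  have hGlim : Tendsto (fun N => ρ.prod P (G N)) atTop (𝓝 0) := by
    have hanti : Antitone G := fun M N hMN p hp i hi => hp i (hi.trans_le hMN)
    have := tendsto_measure_iInter_atTop (μ := ρ.prod P) (fun N => (hGm N).nullMeasurableSet)
      hanti ⟨0, measure_ne_top _ _⟩
    have hzero : ρ.prod P (⋂ N, G N) = 0 := by
      refine measure_mono_null ?_ (h.ae_exists_mem hK.measurableSet hKpos.ne')
      intro p hp hex
      obtain ⟨t, ht, hmem⟩ := hex
      obtain ⟨i, rfl⟩ := hq ▸ ht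
      exact mem_iInter.1 hp (i + 1) i i.lt_succ_self hmem
    rwa [hzero] at this
  refine le_antisymm (ENNReal.le_of_forall_pos_le_add fun ε hε _ => ?_) bot_le
  rw [zero_add]
  have hε' : (0 : ENNReal) < ε := by exact_mod_cast hε
  obtain ⟨N, hN⟩ := (ENNReal.tendsto_nhds_zero.1 hGlim ε hε').exists
  have hlim : Tendsto (fun n => (ε : ENNReal) + ∑ i ∈ Finset.range N, (ρ.prod ρ).prod P
      {p | D.φ (ofNat D.one_mem n + q i) p.2 p.1.1 ∈ K ∧
        ¬ FlowSync (D.flow p.2) p.1.1 p.1.2}) atTop (𝓝 (ε + ∑ i ∈ Finset.range N, 0)) := by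
    refine Tendsto.const_add _ (tendsto_finsetSum _ fun i _ => ?_)
    refine h.tendsto_mem_not_sync hK hA₂ (fun x hx y hy => hδ x (hKA hx) y hy)
      (u := fun n => ofNat D.one_mem n + q i) ?_ ?_
    · exact fun m n hmn => add_le_add_left (monotone_ofNat D.one_mem hmn) _
    · exact tendsto_atTop_mono (fun n => le_add_time _ _) (tendsto_ofNat D.one_mem)
  rw [Finset.sum_const_zero, add_zero] at hlim
  refine ge_of_tendsto' hlim fun n => ?_
  have hGn : (ρ.prod ρ).prod P {p | D.skew (ofNat D.one_mem n) (p.1.1, p.2) ∈ G N} ≤ ε := by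
    have hmp := (h.measurePreserving_skew (ofNat D.one_mem n)).comp
      (measurePreserving_pair_fst (P := P) (ρ := ρ))
    exact (hmp.measure_preimage (hGm N).nullMeasurableSet).trans_le hN
  refine le_trans (measure_mono ?_) ((measure_union_le _ _).trans
    (add_le_add hGn (measure_biUnion_finset_le (Finset.range N) _)))
  intro p hp
  by_cases hpG : D.skew (ofNat D.one_mem n) (p.1.1, p.2) ∈ G N
  · exact Or.inl hpG
  · simp only [G, mem_ofPred_eq, not_forall, not_not] at hpG
    obtain ⟨i, hi, hmem⟩ := hpG
    refine Or.inr (mem_biUnion (Finset.mem_coe.2 (Finset.mem_range.2 hi)) ⟨?_, hp⟩)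
    rw [D.cocycle]
    exact hmem

end ForwardSystem

/-! ### Synchronising regions of a single realisation -/

section Regions

open TopologicalSpace

variable {T : AddSubgroup ℝ} {X : Type*} [MetricSpace X] [SecondCountableTopology X]
  [MeasurableSpace X] [BorelSpace X] {ψ : NonnegTime T → X → X} {ρ : Measure X}
  [IsProbabilityMeasure ρ]

/-- If almost all pairs synchronise and almost every point has a contracting neighbourhood, then
there is a σ-contracting open set of full measure. -/
lemma exists_sigmaContracting_of_ae_sync (hsync : ∀ᵐ x ∂ρ, ∀ᵐ y ∂ρ, FlowSync ψ x y)
    (hnhd : ∀ᵐ x ∂ρ, ∃ B ∈ countableBasis X, x ∈ B ∧ FlowContracts ψ B) :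
    ∃ U : Set X, IsOpen U ∧ ρ U = 1 ∧ ∃ V : ℕ → Set X, Monotone V ∧ (∀ i, IsOpen (V i)) ∧
      U = ⋃ i, V i ∧ ∀ i, FlowContracts ψ (V i) := by
  obtain ⟨x₀, hx₀⟩ := hsync.exists
  let 𝓑 := {B ∈ countableBasis X | FlowContracts ψ B ∧ ρ B ≠ 0}
  have hcount : 𝓑.Countable := (countable_countableBasis X).mono fun B hB => hB.1
  have hsync₀ : ∀ B ∈ 𝓑, ∀ z ∈ B, FlowSync ψ x₀ z := by
    rintro B ⟨-, hc, hpos⟩ z hz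
    obtain ⟨y, hy, hyB⟩ : ∃ y, FlowSync ψ x₀ y ∧ y ∈ B := by
      by_contra! hcon
      exact hpos (measure_mono_null (fun y hyB hy => hcon y hy hyB) hx₀)
    exact hy.trans (hc.sync hyB hz)
  have hfull : ∀ᵐ x ∂ρ, x ∈ ⋃ B ∈ 𝓑, B := by
    have hnull : ∀ᵐ x ∂ρ, ∀ B ∈ countableBasis X, ρ B = 0 → x ∉ B := by
      refine (ae_ball_iff (countable_countableBasis X)).2 fun B _ => ?_
      by_cases h0 : ρ B = 0
      · exact (measure_eq_zero_iff_ae_notMem.1 h0).mono fun x hx _ => hx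
      · exact ae_of_all _ fun x h => absurd h h0
    filter_upwards [hnhd, hnull] with x ⟨B, hB, hxB, hc⟩ hx
    exact mem_biUnion (x := B) ⟨hB, hc, fun h0 => hx B hB h0 hxB⟩ hxB
  have hne : 𝓑.Nonempty := by
    obtain ⟨x, hx⟩ := hfull.exists
    obtain ⟨B, hB, -⟩ := mem_iUnion₂.1 hx
    exact ⟨B, hB⟩
  obtain ⟨f, hf⟩ := hcount.exists_eq_range hne
  have hf𝓑 : ∀ i, f i ∈ 𝓑 := fun i => hf ▸ mem_range_self i
  have hopen : ∀ i, IsOpen (f i) := fun i => isOpen_of_mem_countableBasis (hf𝓑 i).1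
  refine ⟨⋃ i, f i, isOpen_iUnion hopen, ?_, fun i => ⋃ j ∈ Iic i, f j, ?_, ?_, ?_, ?_⟩
  · rw [← mem_ae_iff_prob_eq_one (isOpen_iUnion hopen).measurableSet]
    filter_upwards [hfull] with x hx
    rwa [hf, biUnion_range] at hx
  · exact fun i j hij => biUnion_mono (Iic_subset_Iic.2 hij) fun _ _ => subset_rfl
  · exact fun i => isOpen_biUnion fun j _ => hopen j
  · ext x
    simp only [mem_iUnion, mem_Iic, exists_prop]
    exact ⟨fun ⟨i, h⟩ => ⟨i, i, le_rfl, h⟩, fun ⟨_, j, _, h⟩ => ⟨j, h⟩⟩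
  · exact fun i => FlowContracts.biUnion (finite_Iic i) (fun j _ => (hf𝓑 j).2.1)
      fun j _ k _ x hx y hy => (hsync₀ _ (hf𝓑 j) x hx).symm.trans (hsync₀ _ (hf𝓑 k) y hy)

lemma flowSync_of_mem_iUnion {V : ℕ → Set X} (hV : Monotone V)
    (hc : ∀ i, FlowContracts ψ (V i)) {x y : X} (hx : x ∈ ⋃ i, V i) (hy : y ∈ ⋃ i, V i) :
    FlowSync ψ x y := by
  obtain ⟨i, hi⟩ := mem_iUnion.1 hx
  obtain ⟨j, hj⟩ := mem_iUnion.1 hy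
  exact (hc (max i j)).sync (hV (le_max_left i j) hi) (hV (le_max_right i j) hj)

/-- Sets of positive measure between which there is no synchronisation are at most as many as the
synchronising regions of mass `1/n` covering almost all of the space: each of them meets a region
that none of the others meets. -/
lemma card_le_of_sync_regions {m n : ℕ} (hn : 0 < n) {U : Fin m → Set X} {V : Fin n → Set X}
    (hUpos : ∀ i, ρ (U i) ≠ 0)
    (hUsep : ∀ i j, i ≠ j → ∀ x ∈ U i, ∀ y ∈ U j, ¬ FlowSync ψ x y)
    (hVm : ∀ i, MeasurableSet (V i)) (hVρ : ∀ i, ρ (V i) = (n : ENNReal)⁻¹)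
    (hVsync : ∀ i, ∀ x ∈ V i, ∀ y ∈ V i, FlowSync ψ x y)
    (hVsep : ∀ i j, i ≠ j → ∀ x ∈ V i, ∀ y ∈ V j, ¬ FlowSync ψ x y) : m ≤ n := by
  have hdisj : Pairwise (Function.onFun Disjoint V) := fun i j hij =>
    disjoint_left.2 fun x hx hx' => hVsep i j hij x hx x hx' (hVsync i x hx x hx)
  have hfull : ρ (⋃ j, V j) = 1 := by
    rw [measure_iUnion hdisj hVm, tsum_fintype]
    simp only [hVρ, Finset.sum_const, Finset.card_univ, Fintype.card_fin, nsmul_eq_mul]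
    exact ENNReal.mul_inv_cancel (by exact_mod_cast hn.ne') (ENNReal.natCast_ne_top n)
  have hmeet : ∀ i, ∃ j, (U i ∩ V j).Nonempty := by
    intro i
    by_contra! hcon
    refine hUpos i (measure_mono_null ?_
      ((prob_compl_eq_zero_iff (MeasurableSet.iUnion hVm)).2 hfull))
    intro x hx hxV
    obtain ⟨j, hj⟩ := mem_iUnion.1 hxV
    exact (hcon j).subset ⟨hx, hj⟩
  choose j hj using hmeet
  have hinj : Function.Injective j := by
    intro i i' hii
    by_contra hne
    obtain ⟨x, hxU, hxV⟩ := hj i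
    obtain ⟨y, hyU, hyV⟩ := hj i'
    exact hUsep i i' hne x hxU y hyU (hVsync _ x hxV y (hii ▸ hyV))
  simpa using Fintype.card_le_of_injective j hinj

end Regions

/-- A finite Borel measure on a separable metric space that is a Borel subset of its completion is
inner regular for compact sets. -/
lemma exists_isCompact_of_measurableSet_range_completion {X : Type*} [MetricSpace X]
    [TopologicalSpace.SeparableSpace X] [MeasurableSpace X] [BorelSpace X]
    (hX : @MeasurableSet (UniformSpace.Completion X) (borel (UniformSpace.Completion X))
      (range (fun x : X => (x : UniformSpace.Completion X))))
    (ρ : Measure X) [IsFiniteMeasure ρ] {A : Set X} (hA : MeasurableSet A) {r : ENNReal}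
    (hr : r < ρ A) : ∃ K ⊆ A, IsCompact K ∧ r < ρ K := by
  let _ : MeasurableSpace (UniformSpace.Completion X) := borel _
  have _ : BorelSpace (UniformSpace.Completion X) := ⟨rfl⟩
  have _ : SecondCountableTopology (UniformSpace.Completion X) :=
    UniformSpace.secondCountable_of_separable _
  have hind : IsInducing (fun x : X => (x : UniformSpace.Completion X)) :=
    UniformSpace.Completion.coe_isometry.isEmbedding.isInducing
  have hemb : MeasurableEmbedding (fun x : X => (x : UniformSpace.Completion X)) :=
    UniformSpace.Completion.coe_isometry.isEmbedding.measurableEmbedding hX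
  have hmap : ∀ B : Set X, ρ.map (fun x : X => (x : UniformSpace.Completion X))
      ((fun x : X => (x : UniformSpace.Completion X)) '' B) = ρ B := fun B => by
    rw [hemb.map_apply, hemb.injective.preimage_image]
  obtain ⟨K, hKA, hK, hrK⟩ := (hemb.measurableSet_image.2 hA).exists_lt_isCompact
    (μ := ρ.map (fun x : X => (x : UniformSpace.Completion X))) ((hmap A).symm ▸ hr)
  refine ⟨(fun x : X => (x : UniformSpace.Completion X)) ⁻¹' K, ?_, ?_, ?_⟩
  · rw [← hemb.injective.preimage_image A]
    exact preimage_mono hKA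
  · exact hind.isCompact_preimage' hK (hKA.trans (image_subset_range _ _))
  · rwa [← hemb.map_apply]

/-! ### Consequences of the synchronisation of almost all pairs -/

namespace ForwardSystem

open NonnegTime TopologicalSpace

variable {T : AddSubgroup ℝ} {Ω : Type*} [mΩ : MeasurableSpace Ω] {P : Measure Ω}
  [IsProbabilityMeasure P]
  {X : Type*} [MetricSpace X] [SecondCountableTopology X] [MeasurableSpace X] [BorelSpace X]
  {D : ForwardSystem T Ω P X} {ρ : Measure X} [IsProbabilityMeasure ρ]

lemma ae_sync_iff : (∀ᵐ ω ∂P, ∀ᵐ z ∂ρ.prod ρ, FlowSync (D.flow ω) z.1 z.2) ↔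
    ∀ᵐ p ∂(ρ.prod ρ).prod P, FlowSync (D.flow p.2) p.1.1 p.1.2 := by
  have hm := D.measurableSet_sync
  rw [Measure.ae_prod_iff_ae_ae
    (p := fun p : (X × X) × Ω => FlowSync (D.flow p.2) p.1.1 p.1.2) hm]
  exact (Measure.ae_ae_comm (p := fun (z : X × X) ω => FlowSync (D.flow ω) z.1 z.2) hm).symm

lemma measurableSet_ae_sync :
    MeasurableSet {ω | ∀ᵐ z ∂ρ.prod ρ, FlowSync (D.flow ω) z.1 z.2} := by
  have hm : Measurable fun ω => ρ.prod ρ {z | ¬ FlowSync (D.flow ω) z.1 z.2} :=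
    measurable_measure_prodMk_right (D.measurableSet_sync).compl
  exact measurableSet_eq_fun hm measurable_const

/-- If almost all pairs synchronise, then the trajectories of two typical points visit every open
set of positive measure simultaneously: one of them is recurrent and the other approaches it. -/
lemma Ergodic.exists_full_simultaneous (h : D.Ergodic ρ)
    (hsync : ∀ᵐ ω ∂P, ∀ᵐ z ∂ρ.prod ρ, FlowSync (D.flow ω) z.1 z.2) :
    ∃ A ⊆ ρ.support, ρ Aᶜ = 0 ∧ ∀ x ∈ A, ∀ y ∈ A, ∀ᵐ ω ∂P,
      ∀ U : Set X, IsOpen U → 0 < ρ U → ∃ t, D.φ t ω x ∈ U ∧ D.φ t ω y ∈ U := by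
  have hs : ∀ᵐ x ∂ρ, ∀ᵐ ω ∂P, ∀ᵐ y ∂ρ, FlowSync (D.flow ω) x y := by
    have h1 := Measure.ae_ae_of_ae_prod (Measure.ae_ae_of_ae_prod (ae_sync_iff.1 hsync))
    filter_upwards [h1] with x hx
    refine (Measure.ae_ae_comm (p := fun y ω => FlowSync (D.flow ω) x y) ?_).1 hx
    exact (by fun_prop : Measurable fun q : X × Ω => ((x, q.1), q.2)) D.measurableSet_sync
  refine ⟨{x | x ∈ ρ.support ∧ (∀ᵐ ω ∂P, ∀ᵐ y ∂ρ, FlowSync (D.flow ω) x y) ∧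
    ∀ᵐ ω ∂P, ∀ U : Set X, IsOpen U → 0 < ρ U → ∀ s : ℕ,
      ∃ t, ofNat D.one_mem s ≤ t ∧ D.φ t ω x ∈ U}, fun x hx => hx.1, ?_, ?_⟩
  · have hsupp : ∀ᵐ x ∂ρ, x ∈ ρ.support := Measure.support_mem_ae
    exact hsupp.and (hs.and (Measure.ae_ae_of_ae_prod h.ae_recurrent))
  · rintro x ⟨-, hx, hxr⟩ y ⟨-, hy, -⟩
    filter_upwards [hx, hxr, hy] with ω hxω hrec hyω U hU hpos
    obtain ⟨w, hxw, hyw⟩ := (hxω.and hyω).exists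
    have hxy : FlowSync (D.flow ω) x y := hxw.trans hyw.symm
    obtain ⟨p, hpU, hp⟩ := Measure.nonempty_inter_support_of_pos hpos
    obtain ⟨r, hr, hball⟩ := Metric.isOpen_iff.1 hU p hpU
    have hr2 : 0 < r / 2 := half_pos hr
    obtain ⟨t₀, ht₀⟩ := eventually_atTop.1
      (hxy.tendsto_dist.eventually_lt_const hr2)
    obtain ⟨n, hn⟩ := exists_le_ofNat D.one_mem t₀
    obtain ⟨t, hnt, ht⟩ := hrec _ Metric.isOpen_ball
      ((Measure.mem_support_iff_forall p).1 hp _ (Metric.ball_mem_nhds p hr2)) n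
    refine ⟨t, hball (Metric.ball_subset_ball (by linarith) ht), hball ?_⟩
    have h1 := ht₀ t (hn.trans hnt)
    have h2 : dist (D.φ t ω x) p < r / 2 := ht
    rw [Metric.mem_ball]
    calc dist (D.φ t ω y) p ≤ dist (D.φ t ω y) (D.φ t ω x) + dist (D.φ t ω x) p :=
          dist_triangle _ _ _
      _ < r / 2 + r / 2 := add_lt_add (by rwa [dist_comm]) h2
      _ = r := add_halves r

end ForwardSystem

/-! ### The forward system of a random dynamical system -/

namespace MemorylessNoise

variable {T : AddSubgroup ℝ} {Ω : Type*} [mΩ : MeasurableSpace Ω] {P : Measure Ω}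
  (N : MemorylessNoise T Ω P)

/-- The sample space `Ω` with the σ-algebra `𝓕_0^∞` generated by the future. -/
def FutureSpace (_ : MemorylessNoise T Ω P) : Type _ := Ω

instance : MeasurableSpace N.FutureSpace := ⨆ (u : T) (_ : 0 ≤ u), N.sig 0 u

/-- The identity of `Ω`, as a map that forgets the σ-algebra of the past. -/
def toFuture (ω : Ω) : N.FutureSpace := ω

lemma sig_le {s t : T} (h : s ≤ t) : N.sig s t ≤ mΩ :=
  (le_iSup₂_of_le (f := fun s t => ⨆ (_ : s ≤ t), N.sig s t) s t
    (le_iSup_of_le h le_rfl)).trans N.sig_generate.le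

lemma measurable_toFuture : Measurable N.toFuture :=
  fun _ hA => iSup₂_le (f := fun (u : T) (_ : 0 ≤ u) => N.sig 0 u) (a := mΩ)
    (fun _ hu => N.sig_le hu) _ hA

/-- The law of the noise on the future events. -/
noncomputable def futureMeasure : Measure N.FutureSpace := P.map N.toFuture

instance [IsProbabilityMeasure P] : IsProbabilityMeasure N.futureMeasure :=
  Measure.isProbabilityMeasure_map N.measurable_toFuture.aemeasurable

lemma futureMeasure_apply {A : Set N.FutureSpace} (hA : MeasurableSet A) :
    N.futureMeasure A = P (N.toFuture ⁻¹' A) := Measure.map_apply N.measurable_toFuture hA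

lemma le_futureMeasure (A : Set N.FutureSpace) : P (N.toFuture ⁻¹' A) ≤ N.futureMeasure A :=
  Measure.le_map_apply N.measurable_toFuture.aemeasurable A

/-- The shift by `τ` pulls future events back to events after time `τ`. -/
lemma comap_shift_le {τ : T} :
    MeasurableSpace.comap (N.shift τ) (⨆ (u : T) (_ : 0 ≤ u), N.sig 0 u) ≤
      ⨆ (u : T) (_ : τ ≤ u), N.sig τ u := by
  simp only [MeasurableSpace.comap_iSup]
  refine iSup₂_le fun u hu => ?_
  have hτ : τ ≤ τ + u := le_add_of_nonneg_right hu
  refine le_trans (MeasurableSpace.comap_le_iff_le_map.2 ?_)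
    (le_iSup₂_of_le (f := fun (u : T) (_ : τ ≤ u) => N.sig τ u) (τ + u) hτ le_rfl)
  rw [N.shift_sig τ (τ + u) τ hτ, sub_self, add_sub_cancel_left]

lemma iSup_sig_le {τ : T} (hτ : 0 ≤ τ) :
    ⨆ (u : T) (_ : τ ≤ u), N.sig τ u ≤ ⨆ (u : T) (_ : 0 ≤ u), N.sig 0 u :=
  iSup₂_le fun u hu => le_iSup₂_of_le (f := fun (u : T) (_ : 0 ≤ u) => N.sig 0 u) u (hτ.trans hu)
    (N.sig_mono 0 τ u u hτ hu le_rfl)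

/-- The shift of the noise, as a self-map of the space of futures. -/
def shiftFuture (τ : T) : N.FutureSpace → N.FutureSpace := N.shift τ

lemma measurePreserving_shiftFuture {τ : T} (hτ : 0 ≤ τ) :
    MeasurePreserving (N.shiftFuture τ) N.futureMeasure N.futureMeasure := by
  have hm : Measurable (N.shiftFuture τ) :=
    measurable_iff_comap_le.2 (N.comap_shift_le.trans (N.iSup_sig_le hτ))
  refine ⟨hm, Measure.ext fun A hA => ?_⟩
  rw [Measure.map_apply hm hA, N.futureMeasure_apply (hm hA), N.futureMeasure_apply hA]
  have hmp : MeasurePreserving (N.shift τ) P P := ⟨N.shift_measurable τ, N.stationary τ⟩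
  exact hmp.measure_preimage (N.measurable_toFuture hA).nullMeasurableSet

end MemorylessNoise

namespace RandomDynSys

open NonnegTime TopologicalSpace

variable {T : AddSubgroup ℝ} {Ω : Type*} [mΩ : MeasurableSpace Ω] {P : Measure Ω}
  {N : MemorylessNoise T Ω P} {X : Type*} [MetricSpace X] [MeasurableSpace X]

/-- A random dynamical system over a two-sided noise, seen over the future of the noise only. -/
def toForward (hT : T = AddSubgroup.zmultiples 1 ∨ T = ⊤) (S : RandomDynSys N X) :
    ForwardSystem T N.FutureSpace N.futureMeasure X where
  one_mem := by
    rcases hT with rfl | rfl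
    · exact AddSubgroup.mem_zmultiples 1
    · trivial
  rightDense := exists_antitone_rat_tendsto hT
  F := fun t => N.sig 0 t
  F_mono := fun s t hst => N.sig_mono 0 0 s t le_rfl s.2 hst
  F_le := fun t => le_iSup₂_of_le (f := fun (u : T) (_ : 0 ≤ u) => N.sig 0 u) t.1 t.2 le_rfl
  iSup_F := iSup_subtype (f := fun t : NonnegTime T => N.sig 0 t)
  θ := fun t => N.shiftFuture t
  measurePreserving := fun t => N.measurePreserving_shiftFuture t.2
  indep := fun t => by
    refine (Indep_iff _ _ _).2 fun A B hA hB => ?_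
    have hA' : MeasurableSet[⨆ (u : T) (_ : 0 ≤ u), N.sig 0 u] A :=
      le_iSup₂_of_le (f := fun (u : T) (_ : 0 ≤ u) => N.sig 0 u) t.1 t.2 le_rfl _ hA
    have hB' : MeasurableSet[⨆ (u : T) (_ : (t : T) ≤ u), N.sig t u] B := N.comap_shift_le _ hB
    have hB'' := N.iSup_sig_le t.2 _ hB'
    have hA'' : MeasurableSet[⨆ (s : T) (_ : s ≤ t), N.sig s t] A :=
      le_iSup₂_of_le (f := fun (s : T) (_ : s ≤ t) => N.sig s t) 0 t.2 le_rfl _ hA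
    rw [N.futureMeasure_apply (MeasurableSet.inter hA' hB''), N.futureMeasure_apply hA',
      N.futureMeasure_apply hB'']
    exact (Indep_iff _ _ _).1 (N.memoryless t) A B hA'' hB'
  φ := S.φ
  continuous_space := S.continuous_space
  adapted := S.adapted
  map_zero := S.map_zero
  cocycle := S.cocycle
  right_continuous := S.right_continuous

variable [SecondCountableTopology X] [BorelSpace X] {S : RandomDynSys N X} {ρ : Measure X}

lemma measurable_φ_apply (S : RandomDynSys N X) (t : NonnegTime T) (x : X) :
    Measurable fun ω => S.φ t ω x :=
  (S.adapted t x).mono (N.sig_le t.2) le_rfl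

lemma futureMeasure_φ_mem (hT : T = AddSubgroup.zmultiples 1 ∨ T = ⊤) (t : NonnegTime T) (x : X)
    {A : Set X} (hA : MeasurableSet A) :
    N.futureMeasure {ω | (S.toForward hT).φ t ω x ∈ A} = S.transition t x A := by
  rw [transition, Measure.map_apply (S.measurable_φ_apply t x) hA]
  exact N.futureMeasure_apply ((S.toForward hT).measurable_φ_apply t x hA)

lemma IsErgodic.toForward (hT : T = AddSubgroup.zmultiples 1 ∨ T = ⊤) (h : S.IsErgodic ρ) :
    (S.toForward hT).Ergodic ρ where
  stationary t A hA := by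
    simp only [futureMeasure_φ_mem hT t _ hA]
    exact h.1 t A hA
  zero_or_one A hA hinv := by
    refine h.2 A hA fun t => ?_
    filter_upwards [hinv t] with x hx
    rwa [← futureMeasure_φ_mem hT t x hA]

lemma SigmaContracts.flowSync {ω : Ω} {U : Set X} (h : S.SigmaContracts ω U) {x y : X}
    (hx : x ∈ U) (hy : y ∈ U) : FlowSync (fun t => S.φ t ω) x y := by
  obtain ⟨V, hV, -, rfl, hc⟩ := h
  exact flowSync_of_mem_iUnion hV hc hx hy

variable [IsProbabilityMeasure P] [IsProbabilityMeasure ρ]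

/-- A pair contractible towards a point `p` of a set `A` is contractible towards `A`. -/
lemma contractibleToPoint_subset {p : X} {A : Set X} (hp : p ∈ A) :
    S.contractibleToPoint p ⊆ S.contractibleToSet A := by
  intro q hq V hV
  have hVp : V ∈ 𝓝 (p, p) := mem_nhdsSet_iff_forall.1 hV _ ⟨p, hp, rfl⟩
  rw [nhds_prod_eq] at hVp
  obtain ⟨ε, hε, hsub⟩ := ((Metric.nhds_basis_ball (x := p)).prod_self).mem_iff.1 hVp
  refine (hq ε hε).trans_le (measure_mono ?_)
  rintro ω ⟨t, ht⟩
  exact ⟨t, hsub ht⟩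

lemma IsErgodic.ae_mem_transitivePoints (hT : T = AddSubgroup.zmultiples 1 ∨ T = ⊤)
    (h : S.IsErgodic ρ) : ∀ᵐ x ∂ρ, x ∈ S.transitivePoints ρ := by
  filter_upwards [Measure.support_mem_ae (μ := ρ),
    Measure.ae_ae_of_ae_prod (h.toForward hT).ae_recurrent] with x hx hrec
  refine ⟨hx, fun U hU hpos => pos_iff_ne_zero.2 fun h0 => ?_⟩
  have hrec' := ae_of_ae_map N.measurable_toFuture.aemeasurable hrec
  obtain ⟨ω, h1, h2⟩ := (hrec'.and (measure_eq_zero_iff_ae_notMem.1 h0)).exists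
  obtain ⟨t, -, ht⟩ := h1 U hU hpos 0
  exact h2 ⟨t, ht⟩

lemma isAEStablySynchronising_of_rectangle (hT : T = AddSubgroup.zmultiples 1 ∨ T = ⊤)
    (hX : @MeasurableSet (UniformSpace.Completion X) (borel (UniformSpace.Completion X))
      (range (fun x : X => (x : UniformSpace.Completion X))))
    (h : S.IsErgodic ρ) (hst : S.IsStable ρ)
    (hrect : ContainsFullLengthRectangle ρ (S.contractibleToSet (S.transitivePoints ρ))) :
    S.IsAEStablySynchronising ρ := by
  have hD := h.toForward hT
  obtain ⟨B, hB, hρB, hPB⟩ := ForwardSystem.exists_contracting_basis (D := S.toForward hT)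
    (ρ := ρ) (hst.trans_le (N.le_futureMeasure _))
  obtain ⟨A₁, A₂, hA₁, hA₂, hpos, hone, hsub⟩ := hrect
  have hsync := hD.ae_sync (A₁ := A₁) (A₂ := A₂)
    (exists_isCompact_of_measurableSet_range_completion hX ρ hA₁ hpos)
    (fun r hr => exists_isCompact_of_measurableSet_range_completion hX ρ hA₂ (hone.symm ▸ hr))
    fun x hx y hy => ForwardSystem.eventually_le_prob_sync hB hρB hPB
      (A := S.transitivePoints ρ)
      (fun p hp U hU hUpos => (hp.2 U hU hUpos).trans_le (N.le_futureMeasure _))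
      fun V hV => (hsub (mk_mem_prod hx hy) V hV).trans_le (N.le_futureMeasure _)
  have hnhd := hD.ae_exists_contracting_nhd hB hρB hPB
  have h1 := ForwardSystem.ae_sync_iff.2 hsync
  have h2 : ∀ᵐ ω ∂N.futureMeasure, ∀ᵐ x ∂ρ, ∃ B ∈ countableBasis X, x ∈ B ∧
      FlowContracts ((S.toForward hT).flow ω) B := by
    have hswap := Measure.measurePreserving_swap (μ := N.futureMeasure) (ν := ρ)
    exact Measure.ae_ae_of_ae_prod (hswap.quasiMeasurePreserving.ae hnhd)
  filter_upwards [ae_of_ae_map N.measurable_toFuture.aemeasurable h1,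
    ae_of_ae_map N.measurable_toFuture.aemeasurable h2] with ω hω1 hω2
  exact exists_sigmaContracting_of_ae_sync (Measure.ae_ae_of_ae_prod hω1) hω2

lemma IsAEStablySynchronising.exists_full_simultaneous
    (hT : T = AddSubgroup.zmultiples 1 ∨ T = ⊤) (h : S.IsErgodic ρ)
    (hs : S.IsAEStablySynchronising ρ) :
    ∃ A : Set X, A ⊆ ρ.support ∧ ρ Aᶜ = 0 ∧ ∀ x ∈ A, ∀ y ∈ A, ∀ᵐ ω ∂P,
      ∀ U : Set X, IsOpen U → 0 < ρ U → ∃ t : NonnegTime T, S.φ t ω x ∈ U ∧ S.φ t ω y ∈ U := by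
  have hsync : ∀ᵐ ω ∂N.futureMeasure, ∀ᵐ z ∂ρ.prod ρ,
      FlowSync ((S.toForward hT).flow ω) z.1 z.2 := by
    refine (ae_map_iff N.measurable_toFuture.aemeasurable
      ForwardSystem.measurableSet_ae_sync).2 ?_
    filter_upwards [hs] with ω ⟨U, hU, hρU, hc⟩
    have hUae : ∀ᵐ x ∂ρ, x ∈ U := (mem_ae_iff_prob_eq_one hU.measurableSet).2 hρU
    filter_upwards [Measure.quasiMeasurePreserving_fst.ae hUae,
      Measure.quasiMeasurePreserving_snd.ae hUae] with z h1 h2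
    exact hc.flowSync h1 h2
  obtain ⟨A, hA, hnull, hvis⟩ := (h.toForward hT).exists_full_simultaneous hsync
  exact ⟨A, hA, hnull, fun x hx y hy =>
    ae_of_ae_map N.measurable_toFuture.aemeasurable (hvis x hx y hy)⟩

lemma IsSyncNumber.le {m n : ℕ} (hm : S.IsSyncNumber ρ m) (hn : S.IsSyncNumber ρ n) : m ≤ n := by
  obtain ⟨ω, ⟨U, hU, hUs⟩, V, hV, hVs⟩ := (hm.2.and hn.2).exists
  have hsep : ∀ {k : ℕ} {W : Fin k → Set X}, (∀ i j, i < j → ∀ x ∈ W i, ∀ y ∈ W j,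
      ¬ Tendsto (fun t : NonnegTime T => dist (S.φ t ω x) (S.φ t ω y)) atTop (𝓝 0)) →
      ∀ i j, i ≠ j → ∀ x ∈ W i, ∀ y ∈ W j, ¬ FlowSync (fun t => S.φ t ω) x y := by
    intro k W hW i j hij x hx y hy hxy
    rcases hij.lt_or_gt with h | h
    · exact hW i j h x hx y hy hxy.tendsto_dist
    · exact hW j i h y hy x hx hxy.symm.tendsto_dist
  exact card_le_of_sync_regions (ρ := ρ) hn.1 (fun i => by simp [(hU i).2.1]) (hsep hUs)
    (fun i => (hV i).1.measurableSet) (fun i => (hV i).2.1)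
    (fun i x hx y hy => (hV i).2.2.flowSync hx hy) (hsep hVs)

end RandomDynSys

theorem mainTheorem1 (T : AddSubgroup ℝ) (hT : T = AddSubgroup.zmultiples 1 ∨ T = ⊤)
    {Ω : Type*} [MeasurableSpace Ω] (P : Measure Ω) [IsProbabilityMeasure P]
    (N : MemorylessNoise T Ω P)
    {X : Type*} [MetricSpace X] [TopologicalSpace.SeparableSpace X]
    [MeasurableSpace X] [BorelSpace X]
    (hX : @MeasurableSet (UniformSpace.Completion X) (borel (UniformSpace.Completion X))
      (Set.range (fun x : X => (x : UniformSpace.Completion X))))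
    (S : RandomDynSys N X) (ρ : Measure X) [IsProbabilityMeasure ρ]
    (hρ : S.IsErgodic ρ) (hstable : S.IsStable ρ) :
    List.TFAE [
      ∃ R : Set X, ρ R ≠ 0 ∧ ∀ p ∈ R, ContainsFullLengthRectangle ρ (S.contractibleToPoint p),
      ContainsFullLengthRectangle ρ (S.contractibleToSet (S.transitivePoints ρ)),
      S.IsAEStablySynchronising ρ,
      ∃ A : Set X, A ⊆ ρ.support ∧ ρ Aᶜ = 0 ∧ ∀ x ∈ A, ∀ y ∈ A, ∀ᵐ ω ∂P,
        ∀ U : Set X, IsOpen U → 0 < ρ U →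
          ∃ t : NonnegTime T, S.φ t ω x ∈ U ∧ S.φ t ω y ∈ U,
      S.IsSyncNumber ρ 1] ∧
    ∀ m n : ℕ, S.IsSyncNumber ρ m → S.IsSyncNumber ρ n → m = n := by
  have : SecondCountableTopology X := UniformSpace.secondCountable_of_separable X
  refine ⟨?_, fun m n hm hn => le_antisymm (hm.le hn) (hn.le hm)⟩
  tfae_have 1 → 2 := by
    rintro ⟨R, hR, hrect⟩
    obtain ⟨p, hpR, hp⟩ : ∃ p ∈ R, p ∈ S.transitivePoints ρ := by
      by_contra! hcon
      exact hR (measure_mono_null hcon (hρ.ae_mem_transitivePoints hT))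
    obtain ⟨A₁, A₂, h₁, h₂, h₃, h₄, hsub⟩ := hrect p hpR
    exact ⟨A₁, A₂, h₁, h₂, h₃, h₄, hsub.trans (RandomDynSys.contractibleToPoint_subset hp)⟩
  tfae_have 2 → 3 := RandomDynSys.isAEStablySynchronising_of_rectangle hT hX hρ hstable
  tfae_have 3 → 4 := RandomDynSys.IsAEStablySynchronising.exists_full_simultaneous hT hρ
  tfae_have 4 → 1 := by
    rintro ⟨A, -, hnull, hvis⟩
    have hm := measurableSet_toMeasurable ρ Aᶜ
    have hone : ρ (toMeasurable ρ Aᶜ)ᶜ = 1 := by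
      rw [prob_compl_eq_one_iff hm, measure_toMeasurable, hnull]
    have hsub : (toMeasurable ρ Aᶜ)ᶜ ⊆ A := compl_subset_comm.1 (subset_toMeasurable ρ Aᶜ)
    refine ⟨ρ.support, fun h0 => ?_, fun p hp =>
      ⟨_, _, hm.compl, hm.compl, by simp [hone], hone, ?_⟩⟩
    · exact IsProbabilityMeasure.ne_zero ρ (Measure.measure_univ_eq_zero.1 (by
        rw [← union_compl_self ρ.support]
        exact measure_union_null h0 Measure.measure_compl_support))
    · rintro ⟨x, y⟩ ⟨hx, hy⟩ ε hε
      refine pos_iff_ne_zero.2 fun h0 => ?_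
      obtain ⟨ω, h1, h2⟩ := ((hvis x (hsub hx) y (hsub hy)).and
        (measure_eq_zero_iff_ae_notMem.1 h0)).exists
      obtain ⟨t, ht⟩ := h1 _ Metric.isOpen_ball
        ((Measure.mem_support_iff_forall p).1 hp _ (Metric.ball_mem_nhds p hε))
      exact h2 ⟨t, ht⟩
  tfae_have 3 ↔ 5 := by
    constructor
    · intro h
      refine ⟨one_pos, ?_⟩
      filter_upwards [h] with ω ⟨U, hU, hρU, hc⟩
      exact ⟨fun _ => U, fun _ => ⟨hU, by simpa using hρU, hc⟩,
        fun i j hij => absurd hij (by simp [Subsingleton.elim i j])⟩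
    · rintro ⟨-, h⟩
      filter_upwards [h] with ω ⟨U, hU, _⟩
      exact ⟨U 0, (hU 0).1, by simpa using (hU 0).2.1, (hU 0).2.2⟩
  tfae_finish
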